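/- **Connecting computation-aware batch spatiotemporal GP regression and filtering/smoothing.** *Prior.* Let $\mathbb Z=[t_{\min},t_{\max}]\times\mathbb X$ and let $\mathbf f\sim\mathcal{GP}(\boldsymbol\mu,\boldsymbol\Sigma)$ be a $D'$-output ($D'\ge 1$) space-time separable Gauss–Markov process on $\mathbb Z$: a Gaussian process with $\boldsymbol\mu(t,x)=\mu^x(x)\,\boldsymbol\mu^t(t)\in\mathbb R^{D'}$ and $\boldsymbol\Sigma((t,x),(t',x'))=\Sigma^x(x,x')\,\boldsymbol\Sigma^t(t,t')\in\mathbb R^{D'\times D'}$ ($\mu^x,\Sigma^x$ real-valued), such that there is a Gaussian process $\mathbf f^t\sim\mathcal{GP}(\boldsymbol\mu^t,\boldsymbol\Sigma^t)$ which is Markov with transition laws $\mathbf f^t(t)\mid(\mathbf f^t(r))_{r\le s}\sim\mathcal N(A^t(t,s)\mathbf f^t(s)+b^t(t,s),\,Q^t(t,s))$ for $s\le t$. Let $\mu,\Sigma$ be the mean and covariance functions of the zeroth component $f=\mathbf f_0$. *Data.* Let $t_1<\dots<t_n$ be times in $[t_{\min},t_{\max}]$ with an initial time $t_0\le t_1$,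 let $x_{k,1},\dots,x_{k,N_k}\in\mathbb X$ and $y_k\in\mathbb R^{N_k}$ for $k=1,\dots,n$, let $Z$ be the list of all training inputs $(t_k,x_{k,j})$, let $y=(y_1,\dots,y_n)$, and let $\sigma\ge0$ be the noise scale. Let $(t,x)\in\mathbb Z$ be a test input. *State-space form.* Let $X$ be a finite list of points of $\mathbb X$ that has $x$ as its zeroth entry and contains all $x_{k,j}$. The state $u(t)=\mathbf f(t,X)$ has mean $\boldsymbol\mu^t(t)\otimes\mu^x(X)$, covariance $\Sigma_u(t)=\boldsymbol\Sigma^t(t,t)\otimes\Sigma^x(X,X)$ and transition parameters $A(t,s)=A^t(t,s)\otimes I$, $b(t,s)=b^t(t,s)\otimes\mu^x(X)$. Step $k$ observes $H_ku(t_k)=f(t_k,(x_{k,j})_j)$ with noise covariance $\Lambda_k=\sigma^2I$. Write $\Sigma_k=\Sigma_u(t_k)$, $A_k=A(t_{k+1},t_k)$, $b_k=b(t_{k+1},t_k)$. *Computation-aware filter (CAKF), without truncation.* Start with $m_0=\mathbb E\,u(t_0)$ and $M_0$ the matrix with no columns. For $k=1,\dots,n$ put $m_k^-=A_{k-1}m_{k-1}+b_{k-1}$,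 $M_k^-=A_{k-1}M_{k-1}$, $P_k^-=\Sigma_k-M_k^-(M_k^-)^\top$; an arbitrary policy chooses an action matrix $S_k\in\mathbb R^{N_k\times\check N_k}$ (with arbitrary $\check N_k$); with $\check H_k=S_k^\top H_k$, $\check G_k=\check H_kP_k^-\check H_k^\top+S_k^\top\Lambda_kS_k$, $V_kV_k^\top=\check G_k^\dagger$ (Moore–Penrose pseudoinverse), $w_k=\check H_k^\top\check G_k^\dagger(S_k^\top y_k-\check H_km_k^-)$ and $W_k=\check H_k^\top V_k$, put $m_k=m_k^-+P_k^-w_k$, $M_k=(M_k^-\ \ P_k^-W_k)$, $P_k=\Sigma_k-M_kM_k^\top$. At an arbitrary time $t$, let $k$ be such that $t_k\le t<t_{k+1}$ ($k=0$ if $t<t_1$, $k=n$ if $t\ge t_n$). The filter returns $m(t)=\mathbb E\,u(t)$ and $M(t)$ with no columns if $k=0$; $m_k,M_k$ if $k\ge 1$ and $t=t_k$; and otherwise $m(t)=A(t,t_k)m_k+b(t,t_k)$, $M(t)=A(t,t_k)M_k$. Its covariance is $P(t)=\Sigma_u(t)-M(t)M(t)^\top$. *Computation-aware smoother (CAKS),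 without truncation.* Put $w^s_n=w_n$, $W^s_n=W_n$ and, for $k=n-1,\dots,1$, with $B_k=(I-W_kW_k^\top P_k^-)A_k^\top$, $w^s_k=w_k+B_kw^s_{k+1}$, $W^s_k=(W_k\ \ B_kW^s_{k+1})$. At time $t$ (with $k$ as above), if $k\ge1$ and $t=t_k$ the smoother returns $m^s_k=m_k+P_kA_k^\top w^s_{k+1}$, $M^s_k=(M_k\ \ P_kA_k^\top W^s_{k+1})$ if $k<n$, and $m_n,M_n$ if $k=n$. Otherwise it returns $m^s(t)=m(t)+P(t)A(t_{k+1},t)^\top w^s_{k+1}$, $M^s(t)=(M(t)\ \ P(t)A(t_{k+1},t)^\top W^s_{k+1})$ if $k<n$, and $m(t),M(t)$ if $k=n$. Its covariance is $P^s(t)=\Sigma_u(t)-M^s(t)M^s(t)^\top$. *Iteratively approximated batch GP posterior.* Let $S=\operatorname{blockdiag}(S_1,\dots,S_n)$, $C=S\big(S^\top(\Sigma(Z,Z)+\sigma^2I)S\big)^\dagger S^\top$ and $$\hat\mu(z)=\mu(z)+\Sigma(z,Z)\,C\,(y-\mu(Z)),\qquad\hat\Sigma(z,z')=\Sigma(z,z')-\Sigma(z,Z)\,C\,\Sigma(Z,z').$$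 If $\sigma=0$, assume that the noise-free data are consistent with the prior, in the sense that $S^\top(y-\mu(Z))$ lies in the column space of $S^\top\Sigma(Z,Z)S$ (for instance because $y-\mu(Z)$ is the restriction to $Z$ of a function in the RKHS of $\Sigma$). If $\sigma>0$, nothing is assumed about $y$. *Claim.* The zeroth components (output zero at the test point $x$) of the CAKS moments at time $t$ are the mean and variance of this posterior at the test input: $$m^s(t)_0=\hat\mu(t,x),\qquad P^s(t)_{0,0}=\hat\Sigma((t,x),(t,x)).$$ If $t\ge t_n$, the filter alone suffices: $m(t)_0=\hat\mu(t,x)$ and $P(t)_{0,0}=\hat\Sigma((t,x),(t,x))$. -/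

import Mathlib

open MeasureTheory ProbabilityTheory Matrix
open scoped Kronecker

/-! ### Moore-Penrose pseudoinverse -/

section Pseudoinverse

/-- `B` is the Moore-Penrose pseudoinverse of the real matrix `A`. -/
def IsMoorePenrose {m n : Type*} [Fintype m] [Fintype n]
    (A : Matrix m n ℝ) (B : Matrix n m ℝ) : Prop :=
  A * B * A = A ∧ B * A * B = B ∧ (A * B)ᵀ = A * B ∧ (B * A)ᵀ = B * A

theorem exists_isMoorePenrose_of_isSymm {n : Type*} [Fintype n] (A : Matrix n n ℝ)
    (hA : Aᵀ = A) : ∃ B, IsMoorePenrose A B ∧ Bᵀ = B := by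
  classical
  have hH : A.IsHermitian := by rw [Matrix.IsHermitian, conjTranspose_eq_transpose_of_trivial, hA]
  obtain ⟨U, d, hU, hAd⟩ : ∃ (U : Matrix n n ℝ) (d : n → ℝ), Uᵀ * U = 1 ∧
      A = U * diagonal d * Uᵀ := by
    refine ⟨(hH.eigenvectorUnitary : Matrix n n ℝ), hH.eigenvalues, ?_, ?_⟩
    · have := Unitary.coe_star_mul_self hH.eigenvectorUnitary
      simpa [star_eq_conjTranspose, conjTranspose_eq_transpose_of_trivial] using this
    · have := hH.spectral_theorem
      simpa [Unitary.conjStarAlgAut_apply, star_eq_conjTranspose,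
        conjTranspose_eq_transpose_of_trivial, Function.comp_def] using this
  have key : ∀ a b : n → ℝ, (U * diagonal a * Uᵀ) * (U * diagonal b * Uᵀ)
      = U * diagonal (fun i => a i * b i) * Uᵀ := by
    intro a b
    calc (U * diagonal a * Uᵀ) * (U * diagonal b * Uᵀ)
        = U * diagonal a * (Uᵀ * U) * diagonal b * Uᵀ := by simp only [Matrix.mul_assoc]
      _ = U * diagonal (fun i => a i * b i) * Uᵀ := by
        rw [hU, Matrix.mul_one, Matrix.mul_assoc U, diagonal_mul_diagonal]
  have keyT : ∀ a : n → ℝ, (U * diagonal a * Uᵀ)ᵀ = U * diagonal a * Uᵀ := by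
    intro a
    simp [Matrix.transpose_mul, Matrix.mul_assoc]
  refine ⟨U * diagonal (fun i => (d i)⁻¹) * Uᵀ, ⟨?_, ?_, ?_, ?_⟩, keyT _⟩
  · rw [hAd, key, key]; simp [mul_inv_mul_cancel]
  · rw [hAd, key, key]; congr; ext i
    by_cases h : d i = 0 <;> simp [h]
  · rw [hAd, key, keyT]
  · rw [hAd, key, keyT]

theorem exists_isMoorePenrose {m n : Type*} [Fintype m] [Fintype n] (A : Matrix m n ℝ) :
    ∃ B, IsMoorePenrose A B := by
  classical
  obtain ⟨B, ⟨h1, h2, h3, h4⟩, hs⟩ := exists_isMoorePenrose_of_isSymm (Aᵀ * A)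
    (by rw [transpose_mul, transpose_transpose])
  have hc : A * B * (Aᵀ * A) = A := by
    have h : Aᴴ * A * (B * (Aᵀ * A)) = Aᴴ * A * (1 : Matrix n n ℝ) := by
      rw [conjTranspose_eq_transpose_of_trivial, Matrix.mul_one, ← Matrix.mul_assoc, h1]
    have := (conjTranspose_mul_self_mul_eq_zero A (B * (Aᵀ * A) - 1)).1
      (by rw [Matrix.mul_sub, h, sub_self])
    rw [Matrix.mul_sub, Matrix.mul_one, sub_eq_zero] at this
    rw [Matrix.mul_assoc, this]
  refine ⟨B * Aᵀ, ?_, ?_, ?_, ?_⟩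
  · simpa only [Matrix.mul_assoc] using hc
  · calc B * Aᵀ * A * (B * Aᵀ) = (B * (Aᵀ * A) * B) * Aᵀ := by simp only [Matrix.mul_assoc]
      _ = B * Aᵀ := by rw [h2]
  · simp only [transpose_mul, transpose_transpose, hs, Matrix.mul_assoc]
  · simpa only [Matrix.mul_assoc] using h4

/-- The Moore-Penrose pseudoinverse of a real matrix. -/
noncomputable def pinv {m n : Type*} [Fintype m] [Fintype n] (A : Matrix m n ℝ) :
    Matrix n m ℝ :=
  Classical.choose (exists_isMoorePenrose A)

end Pseudoinverse

/-! ### Gaussian processes and the Markov property -/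

section Processes

open scoped MatrixOrder Matrix.Norms.L2Operator

variable {I T Ω : Type*} [MeasurableSpace Ω] {D : ℕ}

/-- `f ∼ GP(m, K)`: a `D`-output Gaussian process with index set `I`, mean function `m` and
matrix-valued covariance function `K`. -/
structure IsGP (f : I → Ω → EuclideanSpace ℝ (Fin D)) (P : Measure Ω)
    (m : I → Fin D → ℝ) (K : I → I → Matrix (Fin D) (Fin D) ℝ) : Prop where
  gaussian : IsGaussianProcess f P
  mean_eq : ∀ z i, ∫ ω, f z ω i ∂P = m z i
  cov_eq : ∀ z z' i j, cov[fun ω => f z ω i, fun ω => f z' ω j; P] = K z z' i j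

/-- The transition kernel `u ↦ N(A u + b, Q)`. -/
noncomputable def linearGaussianKernel (A : Matrix (Fin D) (Fin D) ℝ) (b : Fin D → ℝ)
    (Q : Matrix (Fin D) (Fin D) ℝ) :
    Kernel (EuclideanSpace ℝ (Fin D)) (EuclideanSpace ℝ (Fin D)) where
  toFun u := multivariateGaussian (WithLp.toLp 2 (A *ᵥ u + b)) Q
  measurable' := by
    have hc : Continuous fun u : EuclideanSpace ℝ (Fin D) =>
        (WithLp.toLp 2 (A *ᵥ u + b) : EuclideanSpace ℝ (Fin D)) := by fun_prop
    have h : ∀ u : EuclideanSpace ℝ (Fin D),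
        multivariateGaussian (WithLp.toLp 2 (A *ᵥ u + b)) Q =
        ((stdGaussian (EuclideanSpace ℝ (Fin D))).map (Prod.mk u)).map
          (fun p => (WithLp.toLp 2 (A *ᵥ p.1 + b) : EuclideanSpace ℝ (Fin D)) +
            toEuclideanCLM (𝕜 := ℝ) (CFC.sqrt Q) p.2) := by
      intro u
      rw [multivariateGaussian, Measure.map_map (by fun_prop) (by fun_prop)]
      rfl
    simp_rw [h]
    exact (Measure.measurable_map _ (by fun_prop)).comp Measurable.map_prodMk_left

/-- `g` is Markov with transition densities
`p(g(t) | g(s)) = N(g(t); A(t, s) g(s) + b(t, s), Q(t, s))`: for `s ≤ t`, the conditional law of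
`g(t)` given the whole past `(g(r))_{r ≤ s}` is `N(A(t, s) g(s) + b(t, s), Q(t, s))`. -/
structure IsMarkovWithTransitions [Preorder T] (g : T → Ω → EuclideanSpace ℝ (Fin D))
    (P : Measure Ω) (A : T → T → Matrix (Fin D) (Fin D) ℝ) (b : T → T → Fin D → ℝ)
    (Q : T → T → Matrix (Fin D) (Fin D) ℝ) : Prop where
  posSemidef : ∀ s t, s ≤ t → (Q t s).PosSemidef
  transition : ∀ s t, s ≤ t →
    HasCondDistrib (g t) (fun ω (r : Set.Iic s) => g r ω)
      ((linearGaussianKernel (A t s) (b t s) (Q t s)).comap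
        (fun path : Set.Iic s → EuclideanSpace ℝ (Fin D) => path ⟨s, le_refl s⟩)
        (measurable_pi_apply _)) P

end Processes

/-! ### Iteratively approximated batch Gaussian process regression -/

section Batch

variable {Z I J : Type*} [Fintype I] [Fintype J] [DecidableEq I]

/-- The Gram matrix `K(Z, Z)`. -/
def gram (K : Z → Z → ℝ) (Zs : I → Z) : Matrix I I ℝ := .of fun i j => K (Zs i) (Zs j)

/-- `C = S (Sᵀ (K(Z, Z) + σ² I) S)† Sᵀ`. -/
noncomputable def approxPrecision (K : Z → Z → ℝ) (σ : ℝ) (Zs : I → Z) (S : Matrix I J ℝ) :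
    Matrix I I ℝ :=
  S * pinv (Sᵀ * (gram K Zs + σ ^ 2 • (1 : Matrix I I ℝ)) * S) * Sᵀ

/-- Mean function of the iteratively approximated batch GP posterior `f | Sᵀ y`. -/
noncomputable def approxPostMean (m : Z → ℝ) (K : Z → Z → ℝ) (σ : ℝ) (Zs : I → Z) (y : I → ℝ)
    (S : Matrix I J ℝ) (z : Z) : ℝ :=
  m z + (fun i => K z (Zs i)) ⬝ᵥ (approxPrecision K σ Zs S *ᵥ (fun i => y i - m (Zs i)))

/-- Covariance function of the iteratively approximated batch GP posterior `f | Sᵀ y`. -/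
noncomputable def approxPostCov (K : Z → Z → ℝ) (σ : ℝ) (Zs : I → Z) (S : Matrix I J ℝ)
    (z z' : Z) : ℝ :=
  K z z' - (fun i => K z (Zs i)) ⬝ᵥ (approxPrecision K σ Zs S *ᵥ (fun i => K (Zs i) z'))

end Batch

/-! ### The computation-aware Kalman filter and RTS smoother (without truncation) -/

/-- A real matrix with rows indexed by `ι` and an arbitrary number of columns. -/
structure TallMatrix (ι : Type*) where
  cols : ℕ
  mat : Matrix ι (Fin cols) ℝ

namespace TallMatrix

variable {ι κ : Type*}

/-- The matrix without columns. -/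
def empty : TallMatrix ι := ⟨0, 0⟩

/-- The block matrix `(M  N)`. -/
def append (M N : TallMatrix ι) : TallMatrix ι :=
  ⟨M.cols + N.cols, .of fun i => Fin.append (M.mat i) (N.mat i)⟩

/-- The product `B M`. -/
def lmul [Fintype ι] (B : Matrix κ ι ℝ) (M : TallMatrix ι) : TallMatrix κ := ⟨M.cols, B * M.mat⟩

/-- `M Mᵀ`. -/
def outer (M : TallMatrix ι) : Matrix ι ι ℝ := M.mat * M.matᵀ

end TallMatrix

/-- The input of the filter and smoother: marginal means `m(t)`, marginal covariances `K(t)`,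
transition matrices `A(t, s)` and offsets `b(t, s)` of a continuous-time Gauss-Markov process with
state space `ℝ^U`, an initial time `time 0`, observation times `time 1, …, time n`, and for
`k = 1, …, n` observations `y k ∈ ℝ^(N k)` with observation matrix `H k` and noise covariance `Λ k`.
Only the indices `k ≤ n` matter. -/
structure CDModel (T U : Type*) where
  m : T → U → ℝ
  K : T → Matrix U U ℝ
  A : T → T → Matrix U U ℝ
  b : T → T → U → ℝ
  n : ℕ
  time : ℕ → T
  N : ℕ → ℕ
  H : ∀ k, Matrix (Fin (N k)) U ℝ
  Λ : ∀ k, Matrix (Fin (N k)) (Fin (N k)) ℝ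
  y : ∀ k, Fin (N k) → ℝ

/-- A policy chooses the action matrix of step `k` (including its number of columns) from the
predictive mean and covariance of step `k`. -/
def CDModel.Policy {T U : Type*} (M : CDModel T U) : Type _ :=
  (k : ℕ) → (U → ℝ) → Matrix U U ℝ → TallMatrix (Fin (M.N k))

/-- A routine that maps a square matrix to a square matrix of the same size. -/
abbrev SquareRoutine : Type := (r : ℕ) → Matrix (Fin r) (Fin r) ℝ → Matrix (Fin r) (Fin r) ℝ

/-- `lsqrt` computes left square roots of positive semidefinite matrices. -/
def IsLeftSqrt (lsqrt : SquareRoutine) : Prop :=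
  ∀ (r : ℕ) (B : Matrix (Fin r) (Fin r) ℝ), B.PosSemidef → lsqrt r B * (lsqrt r B)ᵀ = B

namespace CDModel

variable {T U : Type*} [Fintype U] [DecidableEq U] (M : CDModel T U) (lsqrt : SquareRoutine)
  (policy : M.Policy)

/-- A belief: mean vector, and matrix `d` representing the covariance `K - d dᵀ`. -/
structure Belief (U : Type*) where
  mean : U → ℝ
  dd : TallMatrix U

/-- The predict step leading to time index `k`. -/
def predict (k : ℕ) (s : Belief U) : Belief U where
  mean := M.A (M.time k) (M.time (k - 1)) *ᵥ s.mean + M.b (M.time k) (M.time (k - 1))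
  dd := TallMatrix.lmul (M.A (M.time k) (M.time (k - 1))) s.dd

/-- Everything computed by one update step: the action matrix `S`, the vector `w`, the matrix `W`
and the updated belief. -/
structure UpdateResult (U O : Type*) where
  S : TallMatrix O
  w : U → ℝ
  W : TallMatrix U
  belief : Belief U

/-- The update step at time index `k`, applied to the predictive belief `p`. -/
noncomputable def update (k : ℕ) (p : Belief U) : UpdateResult U (Fin (M.N k)) :=
  let P := M.K (M.time k) - p.dd.outer
  let S := policy k p.mean P
  let H' := S.matᵀ * M.H k
  let Λ' := S.matᵀ * M.Λ k * S.mat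
  let y' := S.matᵀ *ᵥ M.y k
  let G' := H' * P * H'ᵀ + Λ'
  let V := lsqrt S.cols (pinv G')
  let w := H'ᵀ *ᵥ (pinv G' *ᵥ (y' - H' *ᵥ p.mean))
  let W : TallMatrix U := ⟨S.cols, H'ᵀ * V⟩
  { S := S
    w := w
    W := W
    belief := ⟨p.mean + P *ᵥ w, p.dd.append (TallMatrix.lmul P W)⟩ }

/-- The filtering belief at time index `k`. -/
noncomputable def filter : ℕ → Belief U
  | 0 => ⟨M.m (M.time 0), TallMatrix.empty⟩
  | k + 1 => (M.update lsqrt policy (k + 1) (M.predict (k + 1) (filter k))).belief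

/-- The predictive belief at time index `k ≥ 1`. -/
noncomputable def predictive (k : ℕ) : Belief U := M.predict k (M.filter lsqrt policy (k - 1))

/-- The predictive covariance at time index `k ≥ 1`. -/
noncomputable def predictiveCov (k : ℕ) : Matrix U U ℝ :=
  M.K (M.time k) - (M.predictive lsqrt policy k).dd.outer

/-- The quantities computed by the filter's update step at time index `k ≥ 1`. -/
noncomputable def step (k : ℕ) : UpdateResult U (Fin (M.N k)) :=
  M.update lsqrt policy k (M.predictive lsqrt policy k)

/-- The filtering covariance at time index `k`. -/
noncomputable def filterCov (k : ℕ) : Matrix U U ℝ :=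
  M.K (M.time k) - (M.filter lsqrt policy k).dd.outer

/-- `(I - W Wᵀ P⁻) A(time (k + 1), time k)ᵀ` at time index `k`, the factor of the backward
recursion of the smoother. -/
noncomputable def backward (k : ℕ) : Matrix U U ℝ :=
  (1 - (M.step lsqrt policy k).W.outer * M.predictiveCov lsqrt policy k) *
    (M.A (M.time (k + 1)) (M.time k))ᵀ

/-- The backward recursion of the smoother: `smoothAux j k` is the pair `(wˢ, Wˢ)` at time
index `k` if the last time index is `k + j`. -/
noncomputable def smoothAux : ℕ → ℕ → (U → ℝ) × TallMatrix U
  | 0, k => ((M.step lsqrt policy k).w, (M.step lsqrt policy k).W)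
  | j + 1, k =>
    ((M.step lsqrt policy k).w + M.backward lsqrt policy k *ᵥ (smoothAux j (k + 1)).1,
      (M.step lsqrt policy k).W.append
        (TallMatrix.lmul (M.backward lsqrt policy k) (smoothAux j (k + 1)).2))

/-- `wˢ` at time index `1 ≤ k ≤ n`. -/
noncomputable def ws (k : ℕ) : U → ℝ := (M.smoothAux lsqrt policy (M.n - k) k).1

/-- `Wˢ` at time index `1 ≤ k ≤ n`. -/
noncomputable def Ws (k : ℕ) : TallMatrix U := (M.smoothAux lsqrt policy (M.n - k) k).2

/-- The smoother belief at time index `k ≤ n`. -/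
noncomputable def smooth (k : ℕ) : Belief U :=
  let s := M.filter lsqrt policy k
  if k = M.n then s
  else
    let B := M.filterCov lsqrt policy k * (M.A (M.time (k + 1)) (M.time k))ᵀ
    ⟨s.mean + B *ᵥ M.ws lsqrt policy (k + 1),
      s.dd.append (TallMatrix.lmul B (M.Ws lsqrt policy (k + 1)))⟩

variable [LinearOrder T]

/-- The index `k` with `time k ≤ t < time (k + 1)`, where `k = 0` if `t < time 1` and `k = n` if
`time n ≤ t`. -/
def locate (t : T) : ℕ := Nat.findGreatest (fun k => M.time k ≤ t) M.n

/-- The interpolated filtering belief at time `t`. -/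
noncomputable def filterAt (t : T) : Belief U :=
  let k := M.locate t
  if k = 0 then ⟨M.m t, TallMatrix.empty⟩
  else
    let s := M.filter lsqrt policy k
    if t = M.time k then s
    else ⟨M.A t (M.time k) *ᵥ s.mean + M.b t (M.time k), TallMatrix.lmul (M.A t (M.time k)) s.dd⟩

/-- The interpolated filtering covariance at time `t`. -/
noncomputable def filterCovAt (t : T) : Matrix U U ℝ :=
  M.K t - (M.filterAt lsqrt policy t).dd.outer

/-- The interpolated smoother belief at time `t`. -/
noncomputable def smoothAt (t : T) : Belief U :=
  let k := M.locate t
  if k ≠ 0 ∧ t = M.time k then M.smooth lsqrt policy k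
  else
    let s := M.filterAt lsqrt policy t
    if k < M.n then
      let B := M.filterCovAt lsqrt policy t * (M.A (M.time (k + 1)) t)ᵀ
      ⟨s.mean + B *ᵥ M.ws lsqrt policy (k + 1),
        s.dd.append (TallMatrix.lmul B (M.Ws lsqrt policy (k + 1)))⟩
    else s

/-- Mean of the computation-aware filter at time `t`. -/
noncomputable def cakfMean (t : T) : U → ℝ := (M.filterAt lsqrt policy t).mean

/-- Covariance of the computation-aware filter at time `t`. -/
noncomputable def cakfCov (t : T) : Matrix U U ℝ := M.filterCovAt lsqrt policy t

/-- Mean of the computation-aware smoother at time `t`. -/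
noncomputable def caksMean (t : T) : U → ℝ := (M.smoothAt lsqrt policy t).mean

/-- Covariance of the computation-aware smoother at time `t`. -/
noncomputable def caksCov (t : T) : Matrix U U ℝ := M.K t - (M.smoothAt lsqrt policy t).dd.outer

/-- The block-diagonal matrix with the action matrices of steps `1, …, n` on its diagonal. -/
noncomputable def actions :
    Matrix (Σ k : Fin M.n, Fin (M.N (k + 1)))
      (Σ k : Fin M.n, Fin (M.step lsqrt policy (k + 1)).S.cols) ℝ :=
  blockDiagonal' fun k : Fin M.n => (M.step lsqrt policy (k + 1)).S.mat

end CDModel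

/-! ### Space-time separable Gauss-Markov regression in state-space form -/

/-- The state-space model of `u(t) = f(t, X)`, where `f` is a `D`-output space-time separable
Gauss-Markov process with temporal moments `mt`, `Kt`, spatial moments `mx`, `Kx` and temporal
transition parameters `At`, `bt`. The state is indexed by output and spatial point. Step `k`
observes output zero of the process at time `τ k` and the spatial points `X (idx k j)` with
noise covariance `σ² I`. -/
def separableModel {T 𝒳 : Type*} {D NX : ℕ} [NeZero D]
    (mt : T → Fin D → ℝ) (Kt : T → T → Matrix (Fin D) (Fin D) ℝ)
    (mx : 𝒳 → ℝ) (Kx : 𝒳 → 𝒳 → ℝ)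
    (At : T → T → Matrix (Fin D) (Fin D) ℝ) (bt : T → T → Fin D → ℝ)
    (X : Fin NX → 𝒳) (σ : ℝ) (n : ℕ) (τ : ℕ → T) (N : ℕ → ℕ)
    (idx : ∀ k, Fin (N k) → Fin NX) (y : ∀ k, Fin (N k) → ℝ) :
    CDModel T (Fin D × Fin NX) where
  m t := fun p => mt t p.1 * mx (X p.2)
  K t := Kt t t ⊗ₖ gram Kx X
  A t s := At t s ⊗ₖ (1 : Matrix (Fin NX) (Fin NX) ℝ)
  b t s := fun p => bt t s p.1 * mx (X p.2)
  n := n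
  time := τ
  N := N
  H k := .of fun j p => if p = (0, idx k j) then 1 else 0
  Λ k := σ ^ 2 • (1 : Matrix (Fin (N k)) (Fin (N k)) ℝ)
  y := y

/-! ### Properties of the Moore-Penrose pseudoinverse -/

section PseudoinverseLemmas

variable {m n : Type*} [Fintype m] [Fintype n]

/-! The proof is linear algebra on prior moments. Once the filter has run, its action matrices are
fixed, so step `k` is an observation of the state with matrix `E = SᵀH` and noise covariance `L =
SᵀΛS`; how the policy chose `S` plays no role. Filter, smoother and batch posterior all condition
the prior on these projected observations, either one at a time or all at once.

Sequential versus batch: let `G` be the covariance of all projected observations, `c(s)` their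
covariance with the state at `s`, and `r` the residual. Unrolling the sequential updates gives
weights `w(s)` with mean `m + w r`, covariance `K - w cᵀ` and the normal equation `w G = c`
(`weights_mul_batchCov`). If `G` is singular, `w` need not be `c G†`, but `G = G G† G` still turns
`w G wᵀ` into `c G† cᵀ` (`cov_eq_batch`). The mean needs `r` in the range of `G` (`mean_eq_batch`):
automatic for `σ > 0` (`exists_mulVec_eq_of_pos_noise`), assumed for `σ = 0`. Each single update
tolerates a singular innovation covariance because a combination of zero variance has zero
covariance with everything (`mulVec_eq_zero`), so the gain solves its defining equation
(`gain_mul_obsCov`).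

Filter: conditioning on observations no later than `s` preserves `K(t, r) = A(t, s) K(s, r)` for `r
≤ s ≤ t` (`cov_markov`), and the downdate `K - P` then propagates by `A · Aᵀ` alone
(`sub_cov_markov`). Hence multiplying the low-rank factor by `A` is exact (`filter_eq`).

Smoother: an observation at `t_{k+1}` changes an earlier state only through their cross-covariance,
and the factor `B` carries this cross-covariance to the next observation time
(`cov_succ_mul_transition`). The backward recursion therefore sums all later corrections
(`smoothAux_eq`). -/

theorem isMoorePenrose_pinv (A : Matrix m n ℝ) : IsMoorePenrose A (pinv A) :=
  Classical.choose_spec (exists_isMoorePenrose A)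

theorem IsMoorePenrose.unique {A : Matrix m n ℝ} {B C : Matrix n m ℝ}
    (hB : IsMoorePenrose A B) (hC : IsMoorePenrose A C) : B = C := by
  obtain ⟨b1, b2, b3, b4⟩ := hB
  obtain ⟨c1, c2, c3, c4⟩ := hC
  have hl : A * B = A * C := by
    calc A * B = (A * C) * (A * B) := by rw [← Matrix.mul_assoc, c1]
      _ = (A * C)ᵀ * (A * B)ᵀ := by rw [c3, b3]
      _ = (A * B * A * C)ᵀ := by rw [← transpose_mul]; simp only [Matrix.mul_assoc]
      _ = A * C := by rw [b1, c3]
  have hr : B * A = C * A := by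
    calc B * A = (B * A) * (C * A) := by
          rw [Matrix.mul_assoc B, ← Matrix.mul_assoc A C, c1]
      _ = (B * A)ᵀ * (C * A)ᵀ := by rw [c4, b4]
      _ = (C * (A * B * A))ᵀ := by rw [← transpose_mul]; simp only [Matrix.mul_assoc]
      _ = C * A := by rw [b1, c4]
  calc B = B * A * B := b2.symm
    _ = C * (A * C) := by rw [hr, Matrix.mul_assoc, hl]
    _ = C := by rw [← Matrix.mul_assoc, c2]

theorem IsMoorePenrose.transpose {A : Matrix m n ℝ} {B : Matrix n m ℝ}
    (h : IsMoorePenrose A B) : IsMoorePenrose Aᵀ Bᵀ := by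
  obtain ⟨h1, h2, h3, h4⟩ := h
  refine ⟨?_, ?_, ?_, ?_⟩
  · rw [← transpose_mul, ← transpose_mul, ← Matrix.mul_assoc, h1]
  · rw [← transpose_mul, ← transpose_mul, ← Matrix.mul_assoc, h2]
  · rw [← transpose_mul, h4, h4]
  · rw [← transpose_mul, h3, h3]

theorem mul_pinv_mul_self (A : Matrix m n ℝ) : A * pinv A * A = A := (isMoorePenrose_pinv A).1

theorem pinv_mul_mul_pinv (A : Matrix m n ℝ) : pinv A * A * pinv A = pinv A :=
  (isMoorePenrose_pinv A).2.1

theorem transpose_pinv_of_isSymm {A : Matrix n n ℝ} (hA : Aᵀ = A) : (pinv A)ᵀ = pinv A := by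
  have h := (isMoorePenrose_pinv A).transpose
  rw [hA] at h
  exact h.unique (isMoorePenrose_pinv A)

theorem posSemidef_transpose_eq {l : Type*} {A : Matrix l l ℝ} (hA : A.PosSemidef) : Aᵀ = A := by
  rw [← conjTranspose_eq_transpose_of_trivial]; exact hA.isHermitian

/-- For symmetric `A` the pseudoinverse is symmetric, so `A† = A† A (A†)ᵀ` is a congruence of `A`.
This makes the square root `V` of the filter available. -/
theorem posSemidef_pinv {A : Matrix n n ℝ} (hA : A.PosSemidef) : (pinv A).PosSemidef := by
  have h := hA.mul_mul_conjTranspose_same (pinv A)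
  rwa [conjTranspose_eq_transpose_of_trivial,
    transpose_pinv_of_isSymm (posSemidef_transpose_eq hA), pinv_mul_mul_pinv] at h

/-- A matrix whose rows annihilate the kernel of a symmetric matrix `A` has its rows in the
row space of `A`. -/
theorem mul_pinv_mul_of_forall_mulVec_eq_zero {l : Type*} {A : Matrix n n ℝ} {B : Matrix l n ℝ}
    (h : ∀ v, A *ᵥ v = 0 → B *ᵥ v = 0) : B * pinv A * A = B := by
  classical
  have h0 : A * (1 - pinv A * A) = 0 := by
    rw [Matrix.mul_sub, Matrix.mul_one, ← Matrix.mul_assoc, mul_pinv_mul_self, sub_self]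
  -- Each column of `1 - A†A` lies in the kernel of `A`, hence in that of `B`.
  have h1 : B * (1 - pinv A * A) = 0 := by
    ext i j
    have := h (fun k => (1 - pinv A * A) k j) (by
      ext i; exact congrFun (congrFun h0 i) j)
    exact congrFun this i
  rw [Matrix.mul_sub, Matrix.mul_one, sub_eq_zero, ← Matrix.mul_assoc] at h1
  exact h1.symm

/-- Transposed form of the previous lemma: for symmetric `A`, an inclusion of kernels puts the range
of `Bᵀ` inside the range of `A`, and `A†` supplies the preimage. -/
theorem mul_pinv_mulVec_of_forall_mulVec_eq_zero {A : Matrix n n ℝ} (hA : Aᵀ = A)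
    {B : Matrix m n ℝ} (h : ∀ v, A *ᵥ v = 0 → B *ᵥ v = 0) (d : m → ℝ) :
    A *ᵥ (pinv A *ᵥ (Bᵀ *ᵥ d)) = Bᵀ *ᵥ d := by
  have h1 := congrArg Matrix.transpose (mul_pinv_mul_of_forall_mulVec_eq_zero h)
  rw [transpose_mul, transpose_mul, transpose_pinv_of_isSymm hA, hA] at h1
  rw [mulVec_mulVec, mulVec_mulVec, Matrix.mul_assoc, h1]

end PseudoinverseLemmas

/-! ### Conditioning of matrix-valued covariance kernels -/

section Kernel

variable {T U κ : Type*} [Fintype U] [Fintype κ]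

/-- A symmetric positive semidefinite matrix-valued kernel. -/
structure IsPosSemidefKernel (K : T → T → Matrix U U ℝ) : Prop where
  transpose_eq : ∀ s t, (K s t)ᵀ = K t s
  nonneg : ∀ (m : ℕ) (θ : Fin m → T) (c : Fin m → U → ℝ),
    0 ≤ ∑ i, ∑ j, c i ⬝ᵥ (K (θ i) (θ j) *ᵥ c j)

/-- The covariance of the noisy observation with observation matrix `E` and noise covariance `L`. -/
def obsCov (K : T → T → Matrix U U ℝ) (τ : T) (E : Matrix κ U ℝ) (L : Matrix κ κ ℝ) :
    Matrix κ κ ℝ := E * K τ τ * Eᵀ + L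

/-- The gain of the observation at time `τ` with observation matrix `E` and noise covariance `L`. -/
noncomputable def gain (K : T → T → Matrix U U ℝ) (τ : T) (E : Matrix κ U ℝ) (L : Matrix κ κ ℝ)
    (s : T) : Matrix U κ ℝ := K s τ * Eᵀ * pinv (obsCov K τ E L)

/-- The covariance kernel conditioned on a noisy observation at time `τ`. -/
noncomputable def condKernel (K : T → T → Matrix U U ℝ) (τ : T) (E : Matrix κ U ℝ)
    (L : Matrix κ κ ℝ) (s t : T) : Matrix U U ℝ := K s t - gain K τ E L s * E * K τ t

namespace IsPosSemidefKernel

variable {K : T → T → Matrix U U ℝ} (hK : IsPosSemidefKernel K)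
include hK

theorem posSemidef_apply (t : T) : (K t t).PosSemidef := by
  refine PosSemidef.of_dotProduct_mulVec_nonneg ?_ fun x => ?_
  · rw [IsHermitian, conjTranspose_eq_transpose_of_trivial, hK.transpose_eq]
  · simpa using hK.nonneg 1 (fun _ => t) (fun _ => x)

theorem posSemidef_obsCov (τ : T) (E : Matrix κ U ℝ) {L : Matrix κ κ ℝ} (hL : L.PosSemidef) :
    (obsCov K τ E L).PosSemidef := by
  have := (hK.posSemidef_apply τ).mul_mul_conjTranspose_same E
  rw [conjTranspose_eq_transpose_of_trivial] at this
  exact this.add hL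

theorem transpose_pinv_obsCov (τ : T) (E : Matrix κ U ℝ) {L : Matrix κ κ ℝ}
    (hL : L.PosSemidef) : (pinv (obsCov K τ E L))ᵀ = pinv (obsCov K τ E L) :=
  transpose_pinv_of_isSymm (posSemidef_transpose_eq (hK.posSemidef_obsCov τ E hL))

/-- The equality case of Cauchy–Schwarz: a combination with zero variance is uncorrelated with the
process at every time. Perturbing by a multiple `a` of it leaves no `a²` term, so the quadratic form
is affine in `a` and can be nonnegative only if its slope vanishes. -/
theorem mulVec_eq_zero {τ : T} {w : U → ℝ} (hw : w ⬝ᵥ (K τ τ *ᵥ w) = 0) (s : T) :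
    K s τ *ᵥ w = 0 := by
  set u := K s τ *ᵥ w with hu
  have hsymm : w ⬝ᵥ (K τ s *ᵥ u) = u ⬝ᵥ u := by
    rw [dotProduct_mulVec, ← mulVec_transpose, hK.transpose_eq, ← hu]
  have key : ∀ a : ℝ, 0 ≤ 2 * a * (u ⬝ᵥ u) + u ⬝ᵥ (K s s *ᵥ u) := by
    intro a
    have := hK.nonneg 2 ![s, τ] ![u, a • w]
    simp only [Fin.sum_univ_two, Matrix.cons_val_zero, Matrix.cons_val_one, mulVec_smul,
      dotProduct_smul, smul_dotProduct, smul_eq_mul, hw, hsymm, ← hu] at this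
    linarith
  have h0 : u ⬝ᵥ u = 0 := by
    by_contra hne
    -- This `a` makes the affine function equal to `-1`.
    have := key (-(u ⬝ᵥ (K s s *ᵥ u) + 1) / (2 * (u ⬝ᵥ u)))
    rw [show 2 * (-(u ⬝ᵥ (K s s *ᵥ u) + 1) / (2 * (u ⬝ᵥ u))) * (u ⬝ᵥ u)
      = -(u ⬝ᵥ (K s s *ᵥ u) + 1) by field_simp] at this
    linarith
  exact dotProduct_self_eq_zero.1 h0

/-- If `p` is in the kernel of the observation covariance, the signal part and the noise part of its
variance both vanish. The combination `Eᵀ p` then has zero variance, so the right-hand side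
annihilates `p` too, and the pseudoinverse acts as an inverse here. -/
theorem gain_mul_obsCov (τ : T) (E : Matrix κ U ℝ) {L : Matrix κ κ ℝ} (hL : L.PosSemidef)
    (s : T) : gain K τ E L s * obsCov K τ E L = K s τ * Eᵀ := by
  refine mul_pinv_mul_of_forall_mulVec_eq_zero fun p hp => ?_
  have h1 : p ⬝ᵥ (obsCov K τ E L *ᵥ p) = 0 := by rw [hp, dotProduct_zero]
  have h2 := hL.dotProduct_mulVec_nonneg p
  have h3 := (hK.posSemidef_apply τ).dotProduct_mulVec_nonneg (Eᵀ *ᵥ p)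
  have h4 : p ⬝ᵥ ((E * K τ τ * Eᵀ) *ᵥ p) = (Eᵀ *ᵥ p) ⬝ᵥ (K τ τ *ᵥ (Eᵀ *ᵥ p)) := by
    rw [← mulVec_mulVec, ← mulVec_mulVec, dotProduct_mulVec p, ← mulVec_transpose]
  rw [obsCov, add_mulVec, dotProduct_add, h4] at h1
  simp only [star_trivial] at h2 h3
  rw [← mulVec_mulVec]
  exact hK.mulVec_eq_zero (by linarith) s

/-- The covariance of the conditioned process with the observation. -/
theorem condKernel_mul_transpose (τ : T) (E : Matrix κ U ℝ) {L : Matrix κ κ ℝ}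
    (hL : L.PosSemidef) (s : T) : condKernel K τ E L s τ * Eᵀ = gain K τ E L s * L := by
  have h := hK.gain_mul_obsCov τ E hL s
  rw [obsCov, Matrix.mul_add] at h
  rw [condKernel, Matrix.sub_mul, ← h]
  simp only [Matrix.mul_assoc]
  abel

theorem transpose_gain (τ : T) (E : Matrix κ U ℝ) {L : Matrix κ κ ℝ} (hL : L.PosSemidef)
    (s : T) : (gain K τ E L s)ᵀ = pinv (obsCov K τ E L) * E * K τ s := by
  rw [gain, transpose_mul, hK.transpose_pinv_obsCov τ E hL, transpose_mul, transpose_transpose,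
    hK.transpose_eq, Matrix.mul_assoc]

theorem condKernel (τ : T) (E : Matrix κ U ℝ) {L : Matrix κ κ ℝ} (hL : L.PosSemidef) :
    IsPosSemidefKernel (condKernel K τ E L) where
  transpose_eq s t := by
    rw [_root_.condKernel, transpose_sub, transpose_mul, transpose_mul,
      hK.transpose_gain τ E hL, hK.transpose_eq, hK.transpose_eq, _root_.condKernel, gain]
    simp only [Matrix.mul_assoc]
  nonneg m θ c := by
    set G := obsCov K τ E L with hG
    set q : κ → ℝ := E *ᵥ ∑ j, K τ (θ j) *ᵥ c j with hq
    set p : κ → ℝ := pinv G *ᵥ q with hp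
    -- The extra point `τ` with coefficient `-Eᵀ p`, `p = G† q`, subtracts the best linear
    -- prediction from the combination given by `c`. Its prior variance equals the conditional
    -- quadratic form minus `p ⬝ᵥ (L *ᵥ p)`, so adding back this noise term gives nonnegativity.
    have h := hK.nonneg (m + 1) (Fin.cons τ θ) (Fin.cons (-(Eᵀ *ᵥ p)) c)
    simp only [Fin.sum_univ_succ, Fin.cons_zero, Fin.cons_succ] at h
    have e1 : ∑ j, (-(Eᵀ *ᵥ p)) ⬝ᵥ (K τ (θ j) *ᵥ c j) = -(p ⬝ᵥ q) := by
      rw [← dotProduct_sum, neg_dotProduct, mulVec_transpose, ← dotProduct_mulVec, hq]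
    have e2 : ∑ i, c i ⬝ᵥ (K (θ i) τ *ᵥ (-(Eᵀ *ᵥ p))) = -(p ⬝ᵥ q) := by
      rw [← e1]
      refine Finset.sum_congr rfl fun i _ => ?_
      rw [dotProduct_mulVec, ← mulVec_transpose, hK.transpose_eq, dotProduct_comm]
    have e3 : (-(Eᵀ *ᵥ p)) ⬝ᵥ (K τ τ *ᵥ (-(Eᵀ *ᵥ p))) = p ⬝ᵥ q - p ⬝ᵥ (L *ᵥ p) := by
      have a1 : p ⬝ᵥ (G *ᵥ p) = p ⬝ᵥ q := by
        -- Here it matters that `p` lies in the range of `G†`, on which `G† G` is the identity.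
        have : pinv G *ᵥ (G *ᵥ p) = p := by
          rw [hp, mulVec_mulVec, mulVec_mulVec, pinv_mul_mul_pinv]
        calc p ⬝ᵥ (G *ᵥ p) = (pinv G *ᵥ q) ⬝ᵥ (G *ᵥ p) := by rw [hp]
          _ = q ⬝ᵥ (pinv G *ᵥ (G *ᵥ p)) := by
            rw [← hK.transpose_pinv_obsCov τ E hL, mulVec_transpose, ← dotProduct_mulVec,
              hK.transpose_pinv_obsCov τ E hL]
          _ = p ⬝ᵥ q := by rw [this, dotProduct_comm]
      rw [mulVec_neg, neg_dotProduct_neg, ← a1, hG, obsCov, add_mulVec, dotProduct_add,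
        add_sub_cancel_right, ← mulVec_mulVec, ← mulVec_mulVec, mulVec_transpose,
        ← dotProduct_mulVec]
    have e4 : ∑ i, ∑ j, c i ⬝ᵥ ((gain K τ E L (θ i) * E * K τ (θ j)) *ᵥ c j) = p ⬝ᵥ q := by
      simp_rw [← mulVec_mulVec, dotProduct_mulVec (c _) (gain K τ E L _), ← mulVec_transpose,
        hK.transpose_gain τ E hL, ← dotProduct_sum, ← mulVec_sum, ← hq, ← sum_dotProduct,
        ← mulVec_mulVec, ← mulVec_sum, ← hq, ← hG, ← hp]
    simp only [Finset.sum_add_distrib] at h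
    rw [e1, e2, e3] at h
    simp only [_root_.condKernel, sub_mulVec, dotProduct_sub, Finset.sum_sub_distrib]
    rw [e4]
    have := hL.dotProduct_mulVec_nonneg p
    simp only [star_trivial] at this
    linarith

end IsPosSemidefKernel

end Kernel

/-! ### Sequential conditioning and its batch form -/

/-- Prior moments, and a sequence of linear observations of which those with positive index are
processed. -/
structure ObsSequence (T U : Type*) where
  m : T → U → ℝ
  K : T → T → Matrix U U ℝ
  time : ℕ → T
  cols : ℕ → ℕ
  E : ∀ k, Matrix (Fin (cols k)) U ℝ
  L : ∀ k, Matrix (Fin (cols k)) (Fin (cols k)) ℝ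
  y : ∀ k, Fin (cols k) → ℝ

namespace ObsSequence

variable {T U : Type*} [Fintype U] (O : ObsSequence T U)

/-- The covariance kernel conditioned on the observations `1, …, k`. -/
noncomputable def cov : ℕ → T → T → Matrix U U ℝ
  | 0 => O.K
  | k + 1 => condKernel (cov k) (O.time (k + 1)) (O.E (k + 1)) (O.L (k + 1))

/-- The gain of observation `k + 1`. -/
noncomputable def gain (k : ℕ) : T → Matrix U (Fin (O.cols (k + 1))) ℝ :=
  _root_.gain (O.cov k) (O.time (k + 1)) (O.E (k + 1)) (O.L (k + 1))

/-- The mean function conditioned on the observations `1, …, k`. -/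
noncomputable def mean : ℕ → T → U → ℝ
  | 0 => O.m
  | k + 1 => fun s => mean k s +
      O.gain k s *ᵥ (O.y (k + 1) - O.E (k + 1) *ᵥ mean k (O.time (k + 1)))

/-- The weight of observation `j + 1` in the state estimate at time `s` after `k` observations. -/
noncomputable def weight : ℕ → T → ∀ j, Matrix U (Fin (O.cols (j + 1))) ℝ
  | 0 => fun _ _ => 0
  | k + 1 => fun s j => if j = k then O.gain j s else
      weight k s j - O.gain k s * O.E (k + 1) * weight k (O.time (k + 1)) j

theorem cov_succ (k : ℕ) (s t : T) : O.cov (k + 1) s t =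
    O.cov k s t - O.gain k s * O.E (k + 1) * O.cov k (O.time (k + 1)) t := rfl

theorem mean_succ (k : ℕ) (s : T) : O.mean (k + 1) s =
    O.mean k s + O.gain k s *ᵥ (O.y (k + 1) - O.E (k + 1) *ᵥ O.mean k (O.time (k + 1))) := rfl

theorem weight_succ_self (k : ℕ) (s : T) : O.weight (k + 1) s k = O.gain k s := if_pos rfl

theorem weight_succ_of_ne {j k : ℕ} (h : j ≠ k) (s : T) : O.weight (k + 1) s j =
    O.weight k s j - O.gain k s * O.E (k + 1) * O.weight k (O.time (k + 1)) j := if_neg h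

/-- Each update is linear in the current kernel, so the recursion unrolls to prior quantities with
weights that do not depend on `r`. The induction needs all `s` because an update also evaluates the
kernel at the observation time. -/
theorem cov_eq_sub_sum (k : ℕ) (s r : T) : O.cov k s r =
    O.K s r - ∑ j ∈ Finset.range k, O.weight k s j * O.E (j + 1) * O.K (O.time (j + 1)) r := by
  induction k generalizing s with
  | zero => simp [cov]
  | succ k ih =>
    rw [cov_succ, ih s, ih (O.time (k + 1)), Finset.sum_range_succ]
    have h : ∀ j ∈ Finset.range k,
        O.weight (k + 1) s j * O.E (j + 1) * O.K (O.time (j + 1)) r =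
        O.weight k s j * O.E (j + 1) * O.K (O.time (j + 1)) r -
        O.gain k s * O.E (k + 1) *
          (O.weight k (O.time (k + 1)) j * O.E (j + 1) * O.K (O.time (j + 1)) r) := by
      intro j hj
      rw [weight_succ_of_ne _ (Finset.mem_range.1 hj).ne, Matrix.sub_mul, Matrix.sub_mul]
      simp only [Matrix.mul_assoc]
    rw [Finset.sum_congr rfl h, Finset.sum_sub_distrib, ← Finset.mul_sum, Matrix.mul_sub,
      weight_succ_self]
    abel

theorem mean_eq_add_sum (k : ℕ) (s : T) : O.mean k s =
    O.m s + ∑ j ∈ Finset.range k,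
      O.weight k s j *ᵥ (O.y (j + 1) - O.E (j + 1) *ᵥ O.m (O.time (j + 1))) := by
  induction k generalizing s with
  | zero => simp [mean]
  | succ k ih =>
    rw [mean_succ, ih s, ih (O.time (k + 1)), Finset.sum_range_succ]
    have h : ∀ j ∈ Finset.range k,
        O.weight (k + 1) s j *ᵥ (O.y (j + 1) - O.E (j + 1) *ᵥ O.m (O.time (j + 1))) =
        O.weight k s j *ᵥ (O.y (j + 1) - O.E (j + 1) *ᵥ O.m (O.time (j + 1))) -
        O.gain k s *ᵥ (O.E (k + 1) *ᵥ (O.weight k (O.time (k + 1)) j *ᵥ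
          (O.y (j + 1) - O.E (j + 1) *ᵥ O.m (O.time (j + 1))))) := by
      intro j hj
      rw [weight_succ_of_ne _ (Finset.mem_range.1 hj).ne, sub_mulVec, ← mulVec_mulVec, ← mulVec_mulVec]
    rw [Finset.sum_congr rfl h, Finset.sum_sub_distrib, ← mulVec_sum, ← mulVec_sum,
      weight_succ_self, mulVec_add, sub_add_eq_sub_sub, mulVec_sub _ (_ - _)]
    abel

variable {O} (hK : IsPosSemidefKernel O.K) (hL : ∀ k, (O.L k).PosSemidef)
include hK hL

theorem isPosSemidefKernel_cov (k : ℕ) : IsPosSemidefKernel (O.cov k) := by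
  induction k with
  | zero => exact hK
  | succ k ih => exact ih.condKernel _ _ (hL _)

/-- The remaining error correlates with a processed observation only through its noise. This holds
right after the observation is processed, and later updates keep it because both sides obey the same
linear recursion. -/
theorem cov_mul_transpose {k j : ℕ} (hj : j < k) (s : T) :
    O.cov k s (O.time (j + 1)) * (O.E (j + 1))ᵀ = O.weight k s j * O.L (j + 1) := by
  induction k generalizing s with
  | zero => omega
  | succ k ih =>
    by_cases h : j = k
    · subst h
      rw [weight_succ_self]
      exact (isPosSemidefKernel_cov hK hL j).condKernel_mul_transpose _ _ (hL _) s
    · have hjk : j < k := by omega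
      rw [cov_succ, Matrix.sub_mul, ih hjk s, Matrix.mul_assoc _ _ (O.E (j + 1))ᵀ,
        ih hjk (O.time (k + 1)), weight_succ_of_ne _ h, Matrix.sub_mul]
      simp only [Matrix.mul_assoc]

variable (O)
omit hK hL

/-- The index type of all scalar observations among the first `n`. -/
abbrev Index (n : ℕ) : Type := Σ k : Fin n, Fin (O.cols (k + 1))

/-- The covariance of the state at time `s` with all observations. -/
def crossCov (n : ℕ) (s : T) : Matrix U (O.Index n) ℝ :=
  .of fun p i => (O.K s (O.time (i.1 + 1)) * (O.E (i.1 + 1))ᵀ) p i.2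

/-- The covariance of all observations. -/
def batchCov (n : ℕ) : Matrix (O.Index n) (O.Index n) ℝ :=
  (Matrix.of fun i j => (O.E (i.1 + 1) * O.K (O.time (i.1 + 1)) (O.time (j.1 + 1)) *
    (O.E (j.1 + 1))ᵀ) i.2 j.2) + blockDiagonal' fun k : Fin n => O.L (k + 1)

/-- The centered observations. -/
def residual (n : ℕ) : O.Index n → ℝ :=
  fun i => (O.y (i.1 + 1) - O.E (i.1 + 1) *ᵥ O.m (O.time (i.1 + 1))) i.2

/-- The weights of all observations. -/
noncomputable def weights (n : ℕ) (s : T) : Matrix U (O.Index n) ℝ :=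
  .of fun p i => O.weight n s i.1 p i.2

omit [Fintype U] in
theorem mul_blockDiagonal'_apply {l : Type*} {n : ℕ} {a b : Fin n → Type*} [∀ k, Fintype (a k)]
    (B : Matrix l (Σ k, a k) ℝ) (d : ∀ k, Matrix (a k) (b k) ℝ) (i : l) (j : Σ k, b k) :
    (B * blockDiagonal' d) i j = ∑ x, B i ⟨j.1, x⟩ * d j.1 x j.2 := by
  obtain ⟨k, y⟩ := j
  rw [mul_apply, Fintype.sum_sigma, Finset.sum_eq_single k]
  · simp [blockDiagonal'_apply_eq]
  · intro k' _ hk'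
    exact Finset.sum_eq_zero fun x _ => by rw [blockDiagonal'_apply_ne _ _ _ hk', mul_zero]
  · simp

theorem mean_eq_weights (n : ℕ) (s : T) :
    O.mean n s = O.m s + O.weights n s *ᵥ O.residual n := by
  rw [mean_eq_add_sum]
  congr 1
  ext p
  rw [mulVec, dotProduct, Fintype.sum_sigma, Finset.sum_apply, Finset.sum_range]
  rfl

variable {O}
include hK

theorem cov_eq_weights (n : ℕ) (s r : T) :
    O.cov n s r = O.K s r - O.weights n s * (O.crossCov n r)ᵀ := by
  rw [cov_eq_sub_sum]
  congr 1
  ext p q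
  rw [mul_apply, Fintype.sum_sigma, Matrix.sum_apply, Finset.sum_range]
  refine Finset.sum_congr rfl fun j _ => ?_
  rw [Matrix.mul_assoc, mul_apply]
  refine Finset.sum_congr rfl fun a _ => ?_
  change _ = _ * (O.K r (O.time (j + 1)) * (O.E (j + 1))ᵀ) q a
  rw [← transpose_apply (O.K r (O.time (j + 1)) * (O.E (j + 1))ᵀ), transpose_mul,
    transpose_transpose, hK.transpose_eq]
  rfl

include hL

/-- The normal equations: substituting the unrolled kernel into `cov_mul_transpose` gives them one
block column at a time. They determine the estimate even when they do not determine the weights. -/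
theorem weights_mul_batchCov (n : ℕ) (s : T) :
    O.weights n s * O.batchCov n = O.crossCov n s := by
  ext p ⟨k, a⟩
  have h := congrFun (congrFun (cov_mul_transpose hK hL k.2 s) p) a
  rw [cov_eq_sub_sum, Matrix.sub_mul, Matrix.sum_mul, Matrix.sub_apply, Matrix.sum_apply,
    sub_eq_iff_eq_add] at h
  rw [batchCov, Matrix.mul_add, Matrix.add_apply, mul_blockDiagonal'_apply]
  refine Eq.trans ?_ h.symm
  rw [add_comm]
  congr 1
  rw [mul_apply, Fintype.sum_sigma, Finset.sum_range]
  refine Finset.sum_congr rfl fun j _ => ?_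
  rw [Matrix.mul_assoc, Matrix.mul_assoc, mul_apply]
  refine Finset.sum_congr rfl fun b _ => ?_
  rw [← Matrix.mul_assoc]
  rfl

omit hL in
theorem transpose_batchCov (hLs : ∀ k, (O.L k)ᵀ = O.L k) (n : ℕ) :
    (O.batchCov n)ᵀ = O.batchCov n := by
  rw [batchCov, transpose_add, blockDiagonal'_transpose]
  simp only [hLs]
  congr 1
  ext i j
  change (O.E (j.1 + 1) * O.K (O.time (j.1 + 1)) (O.time (i.1 + 1)) * (O.E (i.1 + 1))ᵀ) j.2 i.2
    = (O.E (i.1 + 1) * O.K (O.time (i.1 + 1)) (O.time (j.1 + 1)) * (O.E (j.1 + 1))ᵀ) i.2 j.2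
  rw [← transpose_apply (O.E (j.1 + 1) * _ * _), transpose_mul, transpose_mul,
    transpose_transpose, hK.transpose_eq, Matrix.mul_assoc]

/-- Sequential conditioning agrees with batch conditioning: covariance. -/
theorem cov_eq_batch (n : ℕ) (s r : T) : O.cov n s r =
    O.K s r - O.crossCov n s * pinv (O.batchCov n) * (O.crossCov n r)ᵀ := by
  have hG := transpose_batchCov hK (fun k => posSemidef_transpose_eq (hL k)) n
  rw [cov_eq_weights hK, ← weights_mul_batchCov hK hL n s, ← weights_mul_batchCov hK hL n r,
    transpose_mul, hG]
  congr 1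
  -- With weights on both sides of `G`, inserting `G G† G` regroups them into the two
  -- cross-covariances.
  calc O.weights n s * (O.batchCov n * (O.weights n r)ᵀ)
      = O.weights n s * ((O.batchCov n * pinv (O.batchCov n) * O.batchCov n) *
          (O.weights n r)ᵀ) := by rw [mul_pinv_mul_self]
    _ = _ := by simp only [Matrix.mul_assoc]

/-- Sequential conditioning agrees with batch conditioning: mean. -/
theorem mean_eq_batch (n : ℕ) (s : T)
    (hcons : ∃ v, O.batchCov n *ᵥ v = O.residual n) : O.mean n s =
    O.m s + O.crossCov n s *ᵥ (pinv (O.batchCov n) *ᵥ O.residual n) := by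
  obtain ⟨v, hv⟩ := hcons
  -- Writing the residual as `G v` provides the second factor `G` needed for `G G† G = G`.
  rw [mean_eq_weights, ← weights_mul_batchCov hK hL n s, ← hv, mulVec_mulVec, mulVec_mulVec,
    mulVec_mulVec]
  rw [Matrix.mul_assoc (O.weights n s), Matrix.mul_assoc (O.weights n s), mul_pinv_mul_self]

end ObsSequence

/-! ### Conditioning of Markov processes -/

section Markov

variable {T U : Type*} [Fintype U] [LinearOrder T]

/-- `m` and `K` are the moments of a Markov process with transition matrices `A` and offsets
`b`. -/
structure IsMarkovMoments (m : T → U → ℝ) (K : T → T → Matrix U U ℝ) (A : T → T → Matrix U U ℝ)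
    (b : T → T → U → ℝ) : Prop where
  mean_eq : ∀ {s t}, s ≤ t → m t = A t s *ᵥ m s + b t s
  cov_eq : ∀ {r s t}, r ≤ s → s ≤ t → K t r = A t s * K s r

namespace ObsSequence

variable {O : ObsSequence T U} {A : T → T → Matrix U U ℝ} {b : T → T → U → ℝ}
  (hM : IsMarkovMoments O.m O.K A b)
include hM

/-- An update modifies the first argument only through the covariance with an observation at a time
`≤ s`, where the induction hypothesis applies; the factor `A t s` therefore pulls out of both terms.
-/
theorem cov_markov {k : ℕ} {r s t : T} (hk : ∀ j, j < k → O.time (j + 1) ≤ s) (hr : r ≤ s)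
    (hst : s ≤ t) : O.cov k t r = A t s * O.cov k s r := by
  induction k generalizing r with
  | zero => exact hM.cov_eq hr hst
  | succ k ih =>
    have ih' := fun {r : T} (hr : r ≤ s) => ih (r := r) (fun j hj => hk j (by omega)) hr
    rw [cov_succ, cov_succ, gain, _root_.gain, _root_.gain, ih' hr,
      ih' (hk k (by omega)), Matrix.mul_sub]
    simp only [Matrix.mul_assoc]

theorem mean_markov {k : ℕ} {s t : T} (hk : ∀ j, j < k → O.time (j + 1) ≤ s) (hst : s ≤ t) :
    O.mean k t = A t s *ᵥ O.mean k s + b t s := by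
  induction k with
  | zero => exact hM.mean_eq hst
  | succ k ih =>
    have hk' : ∀ j, j < k → O.time (j + 1) ≤ s := fun j hj => hk j (by omega)
    rw [mean_succ, mean_succ, ih hk', gain, _root_.gain, _root_.gain,
      cov_markov hM hk' (hk k (by omega)) hst, mulVec_add, mulVec_mulVec]
    simp only [Matrix.mul_assoc]
    abel

variable (hK : IsPosSemidefKernel O.K) (hL : ∀ k, (O.L k).PosSemidef)
include hK hL

theorem cov_markov_right {k : ℕ} {r s t : T} (hk : ∀ j, j < k → O.time (j + 1) ≤ s)
    (hr : r ≤ s) (hst : s ≤ t) : O.cov k r t = O.cov k r s * (A t s)ᵀ := by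
  have hk := congrArg Matrix.transpose (cov_markov hM hk hr hst)
  rwa [transpose_mul, (isPosSemidefKernel_cov hK hL _).transpose_eq,
    (isPosSemidefKernel_cov hK hL _).transpose_eq] at hk

/-- The explained covariance is a sum of terms built from cross-covariances with past observations,
and each of these propagates by `A`. Process noise affects prior and posterior equally and cancels
in the difference. -/
theorem sub_cov_markov {k : ℕ} {s t : T} (hk : ∀ j, j < k → O.time (j + 1) ≤ s) (hst : s ≤ t) :
    O.K t t - O.cov k t t = A t s * (O.K s s - O.cov k s s) * (A t s)ᵀ := by
  induction k with
  | zero => simp [cov]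
  | succ k ih =>
    have hk' : ∀ j, j < k → O.time (j + 1) ≤ s := fun j hj => hk j (by omega)
    have h1 := cov_markov hM hk' (hk k (by omega)) hst
    have h2 := cov_markov_right hM hK hL hk' (hk k (by omega)) hst
    rw [cov_succ, cov_succ, ← sub_add, ← sub_add, ih hk', gain, _root_.gain, _root_.gain, h1, h2,
      Matrix.mul_add, Matrix.add_mul]
    simp only [Matrix.mul_assoc]

end ObsSequence

end Markov

/-! ### The filter and the smoother as sequential conditioning -/

namespace TallMatrix

variable {ι κ : Type*}

theorem outer_empty : (empty : TallMatrix ι).outer = 0 := by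
  ext i j
  change ∑ x : Fin 0, (0 : Matrix ι (Fin 0) ℝ) i x * (0 : Matrix ι (Fin 0) ℝ) j x = 0
  exact Fin.sum_univ_zero _

theorem outer_append (M N : TallMatrix ι) : (M.append N).outer = M.outer + N.outer := by
  ext i j
  change ∑ x, Fin.append (M.mat i) (N.mat i) x * Fin.append (M.mat j) (N.mat j) x = _
  rw [Fin.sum_univ_add]
  simp only [Fin.append_left, Fin.append_right]
  rfl

theorem outer_lmul [Fintype ι] (B : Matrix κ ι ℝ) (M : TallMatrix ι) :
    (lmul B M).outer = B * M.outer * Bᵀ := by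
  change B * M.mat * (B * M.mat)ᵀ = B * (M.mat * M.matᵀ) * Bᵀ
  simp only [transpose_mul, Matrix.mul_assoc]

end TallMatrix

namespace CDModel

variable {T U : Type*} [Fintype U] (M : CDModel T U) (lsqrt : SquareRoutine)
  (policy : M.Policy) (K : T → T → Matrix U U ℝ)

/-- The projected observations that the filter processes. -/
noncomputable def obs : ObsSequence T U where
  m := M.m
  K := K
  time := M.time
  cols k := (M.step lsqrt policy k).S.cols
  E k := (M.step lsqrt policy k).S.matᵀ * M.H k
  L k := (M.step lsqrt policy k).S.matᵀ * M.Λ k * (M.step lsqrt policy k).S.mat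
  y k := (M.step lsqrt policy k).S.matᵀ *ᵥ M.y k

variable [LinearOrder T]

/-- The model describes a Gauss-Markov process with covariance kernel `K` that is observed at
increasing times. -/
structure IsGaussMarkov : Prop where
  posSemidef : IsPosSemidefKernel K
  diag : ∀ t, M.K t = K t t
  noise : ∀ k, (M.Λ k).PosSemidef
  markov : IsMarkovMoments M.m K M.A M.b
  time_le : ∀ {j k}, j ≤ k → k ≤ M.n → M.time j ≤ M.time k

variable {M lsqrt policy K} (h : M.IsGaussMarkov K) (hlsqrt : IsLeftSqrt lsqrt)

local notation "𝒪" => M.obs lsqrt policy K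

include h

theorem posSemidef_obs_L (k : ℕ) : ((𝒪).L k).PosSemidef := by
  have := (h.noise k).conjTranspose_mul_mul_same (M.step lsqrt policy k).S.mat
  rwa [conjTranspose_eq_transpose_of_trivial] at this

include hlsqrt

/-- Since `V Vᵀ = G†`, only the product `W Wᵀ` matters and the choice of square root drops out. -/
theorem step_W_outer {k : ℕ}
    (hP : M.predictiveCov lsqrt policy (k + 1) = (𝒪).cov k (M.time (k + 1)) (M.time (k + 1))) :
    (M.step lsqrt policy (k + 1)).W.outer = ((𝒪).E (k + 1))ᵀ *
      pinv (obsCov ((𝒪).cov k) (M.time (k + 1)) ((𝒪).E (k + 1)) ((𝒪).L (k + 1))) *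
        (𝒪).E (k + 1) := by
  have hG := (ObsSequence.isPosSemidefKernel_cov (O := 𝒪) h.posSemidef
    (posSemidef_obs_L h) k).posSemidef_obsCov (M.time (k + 1)) ((𝒪).E (k + 1))
    (posSemidef_obs_L (lsqrt := lsqrt) (policy := policy) h (k + 1))
  have hV := hlsqrt _ _ (posSemidef_pinv hG)
  rw [obsCov, ← hP] at hV ⊢
  obtain ⟨V, hW, hV⟩ : ∃ V : Matrix (Fin ((𝒪).cols (k + 1))) (Fin ((𝒪).cols (k + 1))) ℝ,
      (M.step lsqrt policy (k + 1)).W.outer =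
        ((𝒪).E (k + 1))ᵀ * V * (((𝒪).E (k + 1))ᵀ * V)ᵀ ∧
      V * Vᵀ = pinv ((𝒪).E (k + 1) * M.predictiveCov lsqrt policy (k + 1) *
        ((𝒪).E (k + 1))ᵀ + (𝒪).L (k + 1)) := ⟨_, rfl, hV⟩
  rw [hW, ← hV, transpose_mul, transpose_transpose]
  simp only [Matrix.mul_assoc]

theorem cov_succ_eq {k : ℕ}
    (hP : M.predictiveCov lsqrt policy (k + 1) = (𝒪).cov k (M.time (k + 1)) (M.time (k + 1)))
    (s r : T) : (𝒪).cov (k + 1) s r = (𝒪).cov k s r - (𝒪).cov k s (M.time (k + 1)) *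
      (M.step lsqrt policy (k + 1)).W.outer * (𝒪).cov k (M.time (k + 1)) r := by
  rw [step_W_outer h hlsqrt hP, ObsSequence.cov_succ, ObsSequence.gain, gain]
  simp only [Matrix.mul_assoc]
  rfl

omit [LinearOrder T] h hlsqrt in
theorem mean_succ_eq {k : ℕ}
    (hP : M.predictiveCov lsqrt policy (k + 1) = (𝒪).cov k (M.time (k + 1)) (M.time (k + 1)))
    (hm : (M.predictive lsqrt policy (k + 1)).mean = (𝒪).mean k (M.time (k + 1)))
    (s : T) : (𝒪).mean (k + 1) s = (𝒪).mean k s +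
      (𝒪).cov k s (M.time (k + 1)) *ᵥ (M.step lsqrt policy (k + 1)).w := by
  have hw : (M.step lsqrt policy (k + 1)).w = ((𝒪).E (k + 1))ᵀ *ᵥ
      (pinv ((𝒪).E (k + 1) * M.predictiveCov lsqrt policy (k + 1) * ((𝒪).E (k + 1))ᵀ +
        (𝒪).L (k + 1)) *ᵥ ((𝒪).y (k + 1) -
          (𝒪).E (k + 1) *ᵥ (M.predictive lsqrt policy (k + 1)).mean)) := rfl
  rw [hw, hP, hm, ObsSequence.mean_succ, ObsSequence.gain, gain, mulVec_mulVec, mulVec_mulVec]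
  rfl

/-- Prediction is the Markov propagation of mean and downdate, and the update is one conditioning
step. The predictive claim is stated via `l + 1 = k` because index `0` has no predictive belief. -/
theorem filter_eq {k : ℕ} (hk : k ≤ M.n) :
    (M.filter lsqrt policy k).mean = (𝒪).mean k (M.time k) ∧
    M.filterCov lsqrt policy k = (𝒪).cov k (M.time k) (M.time k) ∧
    ∀ l, l + 1 = k →
      (M.predictive lsqrt policy k).mean = (𝒪).mean l (M.time k) ∧
      M.predictiveCov lsqrt policy k = (𝒪).cov l (M.time k) (M.time k) := by
  induction k with
  | zero =>
    refine ⟨rfl, ?_, by omega⟩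
    rw [filterCov, filter, TallMatrix.outer_empty, sub_zero, h.diag]
    rfl
  | succ k ih =>
    obtain ⟨ihm, ihc, -⟩ := ih (by omega)
    have hO := posSemidef_obs_L (lsqrt := lsqrt) (policy := policy) h
    have hle : ∀ j, j < k → (𝒪).time (j + 1) ≤ M.time k :=
      fun j hj => h.time_le (by omega) (by omega)
    have hle' : M.time k ≤ M.time (k + 1) := h.time_le (by omega) hk
    have hpm : (M.predictive lsqrt policy (k + 1)).mean = (𝒪).mean k (M.time (k + 1)) := by
      rw [ObsSequence.mean_markov (O := 𝒪) h.markov hle hle', ← ihm]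
      rfl
    have hpc : M.predictiveCov lsqrt policy (k + 1) =
        (𝒪).cov k (M.time (k + 1)) (M.time (k + 1)) := by
      have h1 := ObsSequence.sub_cov_markov (O := 𝒪) h.markov h.posSemidef hO hle hle'
      have h2 : (M.filter lsqrt policy k).dd.outer =
          (𝒪).K (M.time k) (M.time k) - (𝒪).cov k (M.time k) (M.time k) := by
        rw [← ihc, filterCov, h.diag]
        exact (sub_sub_cancel _ _).symm
      rw [← h2, ← TallMatrix.outer_lmul] at h1
      rw [predictiveCov, h.diag, sub_eq_iff_eq_add, ← sub_eq_iff_eq_add']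
      exact h1
    refine ⟨?_, ?_, fun l hl => ?_⟩
    · rw [mean_succ_eq hpc hpm, ← hpm, ← hpc]
      rfl
    · rw [cov_succ_eq h hlsqrt hpc, ← hpc]
      have h3 : (M.filter lsqrt policy (k + 1)).dd =
          (M.predictive lsqrt policy (k + 1)).dd.append
            (TallMatrix.lmul (M.predictiveCov lsqrt policy (k + 1))
              (M.step lsqrt policy (k + 1)).W) := rfl
      have h4 : (M.predictiveCov lsqrt policy (k + 1))ᵀ =
          M.predictiveCov lsqrt policy (k + 1) := by
        rw [hpc, (ObsSequence.isPosSemidefKernel_cov (O := 𝒪) h.posSemidef hO k).transpose_eq]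
      rw [filterCov, h3, TallMatrix.outer_append, TallMatrix.outer_lmul, ← sub_sub, h4]
      rfl
    · obtain rfl : l = k := by omega
      exact ⟨hpm, hpc⟩

theorem predictiveCov_eq {k : ℕ} (hk : k + 1 ≤ M.n) : M.predictiveCov lsqrt policy (k + 1) =
    (𝒪).cov k (M.time (k + 1)) (M.time (k + 1)) :=
  ((filter_eq h hlsqrt hk).2.2 k rfl).2

theorem predictive_mean_eq {k : ℕ} (hk : k + 1 ≤ M.n) :
    (M.predictive lsqrt policy (k + 1)).mean = (𝒪).mean k (M.time (k + 1)) :=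
  ((filter_eq h hlsqrt hk).2.2 k rfl).1

variable [DecidableEq U]

/-- Propagate from `time (k + 1)` to the next time by `Aᵀ`, then expand the update at `time (k +
1)`; the common left factor is the cross-covariance before that update. -/
theorem cov_succ_mul_transition {k : ℕ} (hk : k + 1 + 1 ≤ M.n) {s : T}
    (hs : s ≤ M.time (k + 1)) : (𝒪).cov (k + 1) s (M.time (k + 1 + 1)) =
      (𝒪).cov k s (M.time (k + 1)) * M.backward lsqrt policy (k + 1) := by
  rw [ObsSequence.cov_markov_right (O := 𝒪) h.markov h.posSemidef (posSemidef_obs_L h)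
    (fun j hj => h.time_le (by omega) (by omega)) hs (h.time_le (by omega) hk),
    cov_succ_eq h hlsqrt (predictiveCov_eq h hlsqrt (by omega)), backward,
    predictiveCov_eq h hlsqrt (by omega), ← Matrix.mul_assoc, Matrix.mul_sub, Matrix.mul_one,
    Matrix.mul_assoc]

/-- The backward recursion accumulates the effect of the observations `k + 1, …, n` on the
states at times up to `time (k + 1)`. -/
theorem smoothAux_eq (j k : ℕ) (hj : k + 1 + j = M.n) {s : T} (hs : s ≤ M.time (k + 1)) :
    (𝒪).mean M.n s = (𝒪).mean k s +
      (𝒪).cov k s (M.time (k + 1)) *ᵥ (M.smoothAux lsqrt policy j (k + 1)).1 ∧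
    (𝒪).cov M.n s s = (𝒪).cov k s s - (𝒪).cov k s (M.time (k + 1)) *
      (M.smoothAux lsqrt policy j (k + 1)).2.outer * (𝒪).cov k (M.time (k + 1)) s := by
  have hk : k + 1 ≤ M.n := by omega
  have hP := predictiveCov_eq (policy := policy) h hlsqrt hk
  have hc := cov_succ_eq h hlsqrt hP s s
  have hm := mean_succ_eq hP (predictive_mean_eq h hlsqrt hk) s
  -- Induction on the number of remaining observations; `s` stays fixed and lies before all of them.
  induction j generalizing k with
  | zero =>
    rw [← hj]
    exact ⟨hm, hc⟩
  | succ j ih =>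
    have hk' : k + 1 + 1 ≤ M.n := by omega
    have hP' := predictiveCov_eq (policy := policy) h hlsqrt hk'
    obtain ⟨i1, i2⟩ := ih (k + 1) (by omega) (hs.trans (h.time_le (by omega) hk')) hk' hP'
      (cov_succ_eq h hlsqrt hP' s s) (mean_succ_eq hP' (predictive_mean_eq h hlsqrt hk') s)
    have hB := cov_succ_mul_transition (policy := policy) h hlsqrt hk' hs
    have hsymm := fun k => (ObsSequence.isPosSemidefKernel_cov (O := 𝒪) h.posSemidef
      (posSemidef_obs_L h) k).transpose_eq
    have hB' := congrArg Matrix.transpose hB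
    rw [transpose_mul, hsymm, hsymm] at hB'
    constructor
    · rw [i1, hm, hB, smoothAux, mulVec_add, mulVec_mulVec, add_assoc]
    · rw [i2, hc, hB, hB', smoothAux, TallMatrix.outer_append, TallMatrix.outer_lmul,
        Matrix.mul_add, Matrix.add_mul, sub_sub]
      simp only [Matrix.mul_assoc]

/-- The smoother correction at a time `s` between the observations `k` and `k + 1`. -/
theorem smooth_correction {k : ℕ} (hk : k + 1 ≤ M.n) {s : T}
    (hks : ∀ j, j < k → M.time (j + 1) ≤ s) (hs : s ≤ M.time (k + 1)) :
    (𝒪).mean M.n s = (𝒪).mean k s +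
      ((𝒪).cov k s s * (M.A (M.time (k + 1)) s)ᵀ) *ᵥ M.ws lsqrt policy (k + 1) ∧
    (𝒪).cov M.n s s = (𝒪).cov k s s -
      (TallMatrix.lmul ((𝒪).cov k s s * (M.A (M.time (k + 1)) s)ᵀ)
        (M.Ws lsqrt policy (k + 1))).outer := by
  -- The Markov property turns the cross-covariance with the next observation time into `P(s) Aᵀ`,
  -- the form used by the smoother.
  have hA := ObsSequence.cov_markov_right (O := 𝒪) h.markov h.posSemidef (posSemidef_obs_L h)
    hks le_rfl hs
  rw [TallMatrix.outer_lmul, ← hA, (ObsSequence.isPosSemidefKernel_cov (O := 𝒪) h.posSemidef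
    (posSemidef_obs_L h) k).transpose_eq]
  exact smoothAux_eq (policy := policy) h hlsqrt (M.n - (k + 1)) k (by omega) hs

omit [Fintype U] [DecidableEq U] hlsqrt h in
theorem locate_le (t : T) : M.locate t ≤ M.n := Nat.findGreatest_le _

omit [Fintype U] [DecidableEq U] hlsqrt h in
theorem time_locate_le {t : T} (ht : M.locate t ≠ 0) : M.time (M.locate t) ≤ t :=
  Nat.findGreatest_of_ne_zero (P := fun k => M.time k ≤ t) rfl ht

omit [Fintype U] [DecidableEq U] hlsqrt h in
theorem lt_time_of_locate_lt {t : T} {k : ℕ} (hk : M.locate t < k) (hkn : k ≤ M.n) :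
    t < M.time k :=
  not_le.1 (Nat.findGreatest_is_greatest hk hkn)

omit [DecidableEq U] hlsqrt in
theorem time_le_of_le_locate {t : T} {j : ℕ} (hj : j < M.locate t) : M.time (j + 1) ≤ t :=
  (h.time_le hj (locate_le t)).trans (time_locate_le (by omega))

omit [DecidableEq U] in
theorem filterAt_eq (t : T) :
    M.cakfMean lsqrt policy t = (𝒪).mean (M.locate t) t ∧
    M.cakfCov lsqrt policy t = (𝒪).cov (M.locate t) t t := by
  rw [cakfMean, cakfCov, filterCovAt]
  -- With index `0` nothing has been processed and the prior at `t` is returned, so `t` may even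
  -- precede the initial time.
  by_cases h0 : M.locate t = 0
  · rw [filterAt, if_pos h0, h0]
    refine ⟨rfl, ?_⟩
    rw [TallMatrix.outer_empty, sub_zero, h.diag]
    rfl
  obtain ⟨hm, hc, -⟩ := filter_eq (policy := policy) h hlsqrt (locate_le t)
  by_cases ht : t = M.time (M.locate t)
  · rw [filterAt, if_neg h0, if_pos ht, hm]
    refine ⟨by rw [← ht], ?_⟩
    rw [filterCov, ← ht] at hc
    exact hc
  · rw [filterAt, if_neg h0, if_neg ht]
    have hle : ∀ j, j < M.locate t → (𝒪).time (j + 1) ≤ M.time (M.locate t) :=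
      fun j hj => h.time_le hj (locate_le t)
    have hle' := time_locate_le h0
    constructor
    · rw [ObsSequence.mean_markov (O := 𝒪) h.markov hle hle', ← hm]
    · have h1 := ObsSequence.sub_cov_markov (O := 𝒪) h.markov h.posSemidef
        (posSemidef_obs_L h) hle hle'
      have h2 : (M.filter lsqrt policy (M.locate t)).dd.outer =
          (𝒪).K (M.time (M.locate t)) (M.time (M.locate t)) -
            (𝒪).cov (M.locate t) (M.time (M.locate t)) (M.time (M.locate t)) := by
        rw [← hc, filterCov, h.diag]
        exact (sub_sub_cancel _ _).symm
      rw [← h2, ← TallMatrix.outer_lmul] at h1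
      rw [h.diag, sub_eq_iff_eq_add, ← sub_eq_iff_eq_add']
      exact h1

/-- At and between observation times the output is the filter belief plus the same correction from
the observations after `locate t`; when none remain, the filter is already the full posterior. -/
theorem smoothAt_eq (t : T) :
    M.caksMean lsqrt policy t = (𝒪).mean M.n t ∧
    M.caksCov lsqrt policy t = (𝒪).cov M.n t t := by
  have hks : ∀ j, j < M.locate t → M.time (j + 1) ≤ t := fun j hj => time_le_of_le_locate h hj
  rw [caksMean, caksCov, smoothAt]
  dsimp only
  split_ifs with h1 h2
  · obtain ⟨hm, hc, -⟩ := filter_eq (policy := policy) h hlsqrt (locate_le t)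
    rw [← h1.2] at hm hc
    rw [smooth]
    dsimp only
    split_ifs with h3
    · rw [h3] at hm hc
      rw [h3]
      rw [filterCov, ← h3, ← h1.2, h3] at hc
      exact ⟨hm, hc⟩
    · have hk : M.locate t + 1 ≤ M.n := by have := locate_le (M := M) t; omega
      obtain ⟨e1, e2⟩ := smooth_correction (policy := policy) h hlsqrt hk hks
        (lt_time_of_locate_lt (by omega) hk).le
      rw [e1, e2, TallMatrix.outer_append, ← sub_sub, hc, hm]
      rw [filterCov] at hc
      rw [← h1.2] at hc ⊢
      rw [hc]
      exact ⟨rfl, rfl⟩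
  · obtain ⟨hm, hc⟩ := filterAt_eq (policy := policy) h hlsqrt t
    obtain ⟨e1, e2⟩ := smooth_correction (policy := policy) h hlsqrt h2 hks
      (lt_time_of_locate_lt (by omega) h2).le
    rw [cakfMean] at hm
    rw [cakfCov] at hc
    rw [e1, e2, TallMatrix.outer_append, ← sub_sub, ← filterCovAt, hc, hm]
    exact ⟨rfl, rfl⟩
  · have hn : M.locate t = M.n := le_antisymm (locate_le t) (not_lt.1 h2)
    have := filterAt_eq (policy := policy) h hlsqrt t
    rwa [hn] at this

omit [DecidableEq U] in
theorem filterAt_eq_of_le {t : T} (ht : M.time M.n ≤ t) :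
    M.cakfMean lsqrt policy t = (𝒪).mean M.n t ∧
    M.cakfCov lsqrt policy t = (𝒪).cov M.n t t := by
  have hn : M.locate t = M.n :=
    le_antisymm (locate_le t) (Nat.le_findGreatest (P := fun k => M.time k ≤ t) le_rfl ht)
  have := filterAt_eq (policy := policy) h hlsqrt t
  rwa [hn] at this

end CDModel

/-! ### Projected observations -/

theorem transpose_blockDiagonal'_mul_apply {l : Type*} {n : ℕ} {a b : Fin n → Type*}
    [∀ k, Fintype (a k)] (d : ∀ k, Matrix (a k) (b k) ℝ) (B : Matrix (Σ k, a k) l ℝ)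
    (i : Σ k, b k) (j : l) :
    ((blockDiagonal' d)ᵀ * B) i j = ∑ x, d i.1 x i.2 * B ⟨i.1, x⟩ j := by
  rw [← transpose_apply ((blockDiagonal' d)ᵀ * B), transpose_mul, transpose_transpose,
    ObsSequence.mul_blockDiagonal'_apply]
  exact Finset.sum_congr rfl fun x _ => mul_comm _ _

namespace ObsSequence

variable {T U : Type*} [Fintype U] {O : ObsSequence T U} {n : ℕ} {N : Fin n → ℕ}
  {S : ∀ k : Fin n, Matrix (Fin (N k)) (Fin (O.cols (k + 1))) ℝ}
  {H : ∀ k : Fin n, Matrix (Fin (N k)) U ℝ}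
  (hE : ∀ k : Fin n, O.E (k + 1) = (S k)ᵀ * H k)
include hE

theorem crossCov_eq (s : T) (p : U) {g : (Σ k : Fin n, Fin (N k)) → ℝ}
    (hg : ∀ i, g i = (O.K s (O.time (i.1 + 1)) * (H i.1)ᵀ) p i.2) :
    O.crossCov n s p = (blockDiagonal' S)ᵀ *ᵥ g := by
  ext ⟨k, a⟩
  -- The vector is viewed as a one-column matrix so that the block-diagonal product formula applies.
  change (O.K s (O.time (k + 1)) * (O.E (k + 1))ᵀ) p a =
    ((blockDiagonal' S)ᵀ * (Matrix.of fun i (_ : Unit) => g i)) ⟨k, a⟩ ()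
  rw [transpose_blockDiagonal'_mul_apply, hE, transpose_mul, transpose_transpose,
    ← Matrix.mul_assoc, mul_apply]
  refine Finset.sum_congr rfl fun x _ => ?_
  rw [mul_comm, of_apply, hg]

theorem residual_eq {y : ∀ k : Fin n, Fin (N k) → ℝ}
    (hy : ∀ k : Fin n, O.y (k + 1) = (S k)ᵀ *ᵥ y k) {r : (Σ k : Fin n, Fin (N k)) → ℝ}
    (hr : ∀ i, r i = (y i.1 - H i.1 *ᵥ O.m (O.time (i.1 + 1))) i.2) :
    O.residual n = (blockDiagonal' S)ᵀ *ᵥ r := by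
  ext ⟨k, a⟩
  change (O.y (k + 1) - O.E (k + 1) *ᵥ O.m (O.time (k + 1))) a =
    ((blockDiagonal' S)ᵀ * (Matrix.of fun i (_ : Unit) => r i)) ⟨k, a⟩ ()
  rw [transpose_blockDiagonal'_mul_apply, hE, hy, ← mulVec_mulVec, ← mulVec_sub,
    mulVec, dotProduct]
  refine Finset.sum_congr rfl fun x _ => ?_
  rw [of_apply, hr]
  rfl

theorem batchCov_eq {σ : ℝ}
    (hL : ∀ k : Fin n, O.L (k + 1) = (S k)ᵀ * (σ ^ 2 • (1 : Matrix (Fin (N k)) (Fin (N k)) ℝ)) * S k)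
    {Γ : Matrix (Σ k : Fin n, Fin (N k)) (Σ k : Fin n, Fin (N k)) ℝ}
    (hΓ : ∀ i j, Γ i j =
      (H i.1 * O.K (O.time (i.1 + 1)) (O.time (j.1 + 1)) * (H j.1)ᵀ) i.2 j.2) :
    O.batchCov n = (blockDiagonal' S)ᵀ * (Γ + σ ^ 2 • 1) * blockDiagonal' S := by
  rw [batchCov, Matrix.mul_add, Matrix.add_mul]
  congr 1
  · ext ⟨k, a⟩ ⟨l, b⟩
    rw [Matrix.mul_assoc, transpose_blockDiagonal'_mul_apply, of_apply]
    change (O.E (k + 1) * O.K (O.time (k + 1)) (O.time (l + 1)) * (O.E (l + 1))ᵀ) a b = _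
    rw [hE, hE, transpose_mul, transpose_transpose,
      show (S k)ᵀ * H k * O.K (O.time (k + 1)) (O.time (l + 1)) * ((H l)ᵀ * S l) =
        (S k)ᵀ * (H k * O.K (O.time (k + 1)) (O.time (l + 1)) * (H l)ᵀ * S l) by
          simp only [Matrix.mul_assoc], mul_apply]
    refine Finset.sum_congr rfl fun x _ => ?_
    rw [mul_blockDiagonal'_apply, mul_apply, transpose_apply]
    congr 1
    exact Finset.sum_congr rfl fun z _ => by rw [hΓ]
  · rw [Matrix.mul_smul, Matrix.smul_mul, Matrix.mul_one, blockDiagonal'_transpose,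
      ← blockDiagonal'_mul, ← blockDiagonal'_smul]
    congr 1
    ext1 k
    have h : O.L (k + 1) = σ ^ 2 • ((S k)ᵀ * S k) := by
      rw [hL, Matrix.mul_smul, Matrix.smul_mul, Matrix.mul_one]
    exact h

end ObsSequence

/-- Projected residuals of a positive semidefinite Gram matrix with positive noise are
consistent. -/
theorem exists_mulVec_eq_of_pos_noise {I J : Type*} [Fintype I] [Fintype J] [DecidableEq I]
    {Γ : Matrix I I ℝ} (hΓ : Γ.PosSemidef) {σ : ℝ} (hσ : 0 < σ) (S : Matrix I J ℝ) (r : I → ℝ) :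
    ∃ v, (Sᵀ * (Γ + σ ^ 2 • (1 : Matrix I I ℝ)) * S) *ᵥ v = Sᵀ *ᵥ r := by
  have hsymm : (Sᵀ * (Γ + σ ^ 2 • (1 : Matrix I I ℝ)) * S)ᵀ =
      Sᵀ * (Γ + σ ^ 2 • (1 : Matrix I I ℝ)) * S := by
    rw [transpose_mul, transpose_mul, transpose_transpose, transpose_add, transpose_smul,
      transpose_one, posSemidef_transpose_eq hΓ, Matrix.mul_assoc]
  refine ⟨_, mul_pinv_mulVec_of_forall_mulVec_eq_zero hsymm (fun v hv => ?_) r⟩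
  have h1 : (S *ᵥ v) ⬝ᵥ ((Γ + σ ^ 2 • (1 : Matrix I I ℝ)) *ᵥ (S *ᵥ v)) = 0 := by
    rw [← mulVec_mulVec, ← mulVec_mulVec] at hv
    rw [dotProduct_comm, dotProduct_mulVec, ← mulVec_transpose, hv, zero_dotProduct]
  have h2 := hΓ.dotProduct_mulVec_nonneg (S *ᵥ v)
  rw [add_mulVec, dotProduct_add, smul_mulVec, one_mulVec, dotProduct_smul, smul_eq_mul] at h1
  simp only [star_trivial] at h2
  have h3 : 0 ≤ (S *ᵥ v) ⬝ᵥ (S *ᵥ v) := Finset.sum_nonneg fun i _ => mul_self_nonneg _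
  have h4 : (S *ᵥ v) ⬝ᵥ (S *ᵥ v) = 0 := by
    have := pow_pos hσ 2
    nlinarith
  -- With `σ > 0` the kernel of the projected covariance is contained in that of `S`, so its range
  -- contains that of `Sᵀ`.
  exact dotProduct_self_eq_zero.1 h4

/-! ### Moments of Gaussian processes and of Markov transitions -/

section MarkovMoments

variable {I T Ω : Type*} [MeasurableSpace Ω] {D : ℕ} {P : Measure Ω}

theorem IsGP.memLp {f : I → Ω → EuclideanSpace ℝ (Fin D)} {m : I → Fin D → ℝ}
    {K : I → I → Matrix (Fin D) (Fin D) ℝ} (hf : IsGP f P m K) (z : I) (i : Fin D) :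
    MemLp (fun ω => f z ω i) 2 P := by
  have h := (hf.gaussian.hasGaussianLaw_eval z).memLp_two
  exact h.continuousLinearMap_comp (EuclideanSpace.proj (𝕜 := ℝ) i)

theorem IsGP.transpose_eq {f : I → Ω → EuclideanSpace ℝ (Fin D)} {m : I → Fin D → ℝ}
    {K : I → I → Matrix (Fin D) (Fin D) ℝ} (hf : IsGP f P m K) (z z' : I) :
    (K z z')ᵀ = K z' z := by
  ext i j
  rw [transpose_apply, ← hf.cov_eq, ← hf.cov_eq, covariance_comm]

/-- A linear combination of the covariances of a process is the variance of a linear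
combination. -/
theorem IsGP.sum_cov_nonneg {f : I → Ω → EuclideanSpace ℝ (Fin D)} {m : I → Fin D → ℝ}
    {K : I → I → Matrix (Fin D) (Fin D) ℝ} [IsProbabilityMeasure P] (hf : IsGP f P m K)
    {ι : Type*} [Fintype ι] (z : ι → I) (o : ι → Fin D) (c : ι → ℝ) :
    0 ≤ ∑ a, ∑ b, c a * K (z a) (z b) (o a) (o b) * c b := by
  have hmem : ∀ a, MemLp (fun ω => c a * f (z a) ω (o a)) 2 P := fun a =>
    (hf.memLp (z a) (o a)).const_mul (c a)
  have h : cov[fun ω => ∑ a, c a * f (z a) ω (o a), fun ω => ∑ a, c a * f (z a) ω (o a); P]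
      = ∑ a, ∑ b, c a * K (z a) (z b) (o a) (o b) * c b := by
    rw [covariance_fun_sum_fun_sum hmem hmem]
    refine Finset.sum_congr rfl fun a _ => Finset.sum_congr rfl fun b _ => ?_
    rw [covariance_const_mul_left, covariance_const_mul_right, hf.cov_eq]
    ring
  rw [← h, covariance_self (memLp_finsetSum _ fun a _ => hmem a).aemeasurable]
  exact variance_nonneg _ _

variable [IsProbabilityMeasure P] [Preorder T] {g : T → Ω → EuclideanSpace ℝ (Fin D)}
  {A : T → T → Matrix (Fin D) (Fin D) ℝ} {b : T → T → Fin D → ℝ}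
  {Q : T → T → Matrix (Fin D) (Fin D) ℝ}

instance (A : Matrix (Fin D) (Fin D) ℝ) (b : Fin D → ℝ) (Q : Matrix (Fin D) (Fin D) ℝ) :
    IsMarkovKernel (linearGaussianKernel A b Q) where
  isProbabilityMeasure u := by
    change IsProbabilityMeasure (multivariateGaussian (WithLp.toLp 2 (A *ᵥ u + b)) Q)
    infer_instance

theorem integral_linearGaussianKernel (A : Matrix (Fin D) (Fin D) ℝ) (b : Fin D → ℝ)
    (Q : Matrix (Fin D) (Fin D) ℝ) (u : EuclideanSpace ℝ (Fin D)) (i : Fin D) :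
    ∫ v, v i ∂(linearGaussianKernel A b Q u) = (A *ᵥ u + b) i := by
  change ∫ v, v i ∂(multivariateGaussian (WithLp.toLp 2 (A *ᵥ u + b)) Q) = _
  have h := (EuclideanSpace.proj (𝕜 := ℝ) i).integral_comp_comm
    (IsGaussian.integrable_id (μ := multivariateGaussian (WithLp.toLp 2 (A *ᵥ u + b)) Q))
  simpa using h

/-- The tower property for a Markov process with linear Gaussian transitions. -/
theorem IsMarkovWithTransitions.integral_mul (hg : IsMarkovWithTransitions g P A b Q)
    {s t : T} (hst : s ≤ t) (i : Fin D) (φ : (Set.Iic s → EuclideanSpace ℝ (Fin D)) → ℝ)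
    (hφ : Measurable φ)
    (hint : Integrable (fun ω => φ (fun r => g r ω) * g t ω i) P) :
    ∫ ω, φ (fun r => g r ω) * g t ω i ∂P =
      ∫ ω, φ (fun r => g r ω) * (A t s *ᵥ g s ω + b t s) i ∂P := by
  have h := hg.transition s t hst
  set X : Ω → (Set.Iic s → EuclideanSpace ℝ (Fin D)) := fun ω r => g r ω with hX
  have hXm : AEMeasurable X P := h.aemeasurable_fst
  set F : (Set.Iic s → EuclideanSpace ℝ (Fin D)) × EuclideanSpace ℝ (Fin D) → ℝ :=
    fun p => φ p.1 * p.2 i with hF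
  have hFm : Measurable F := by
    refine (hφ.comp measurable_fst).mul ?_
    exact (EuclideanSpace.proj (𝕜 := ℝ) i).continuous.measurable.comp measurable_snd
  have hpair : AEMeasurable (fun ω => (X ω, g t ω)) P := h.aemeasurable
  have hFint : Integrable F (P.map fun ω => (X ω, g t ω)) :=
    (integrable_map_measure hFm.aestronglyMeasurable hpair).2 hint
  have h1 : ∫ ω, φ (X ω) * g t ω i ∂P = ∫ p, F p ∂(P.map fun ω => (X ω, g t ω)) :=
    (integral_map hpair hFm.aestronglyMeasurable).symm
  have := HasLaw.map_eq h
  rw [h1, this]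
  rw [this] at hFint
  -- The joint law of past and present disintegrates along the transition kernel, so the inner
  -- integral is the conditional mean.
  rw [Measure.integral_compProd hFint]
  have h2 : ∀ x : Set.Iic s → EuclideanSpace ℝ (Fin D),
      ∫ y, F (x, y) ∂((linearGaussianKernel (A t s) (b t s) (Q t s)).comap
        (fun path : Set.Iic s → EuclideanSpace ℝ (Fin D) => path ⟨s, le_refl s⟩)
        (measurable_pi_apply _) x) = φ x * (A t s *ᵥ x ⟨s, le_refl s⟩ + b t s) i := by
    intro x
    simp only [hF, Kernel.comap_apply, integral_const_mul, integral_linearGaussianKernel]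
  simp_rw [h2]
  rw [integral_map hXm]
  refine Measurable.aestronglyMeasurable (hφ.mul ?_)
  have hc : Continuous fun u : EuclideanSpace ℝ (Fin D) => (A t s *ᵥ u + b t s) i := by
    fun_prop
  exact hc.measurable.comp (measurable_pi_apply (⟨s, le_refl s⟩ : Set.Iic s))

theorem IsMarkovWithTransitions.mean_eq {m : T → Fin D → ℝ}
    {K : T → T → Matrix (Fin D) (Fin D) ℝ} (hg : IsMarkovWithTransitions g P A b Q)
    (hgp : IsGP g P m K) {s t : T} (hst : s ≤ t) : m t = A t s *ᵥ m s + b t s := by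
  ext i
  have h1 := hg.integral_mul hst i (fun _ => 1) measurable_const
    (by simpa using (hgp.memLp t i).integrable one_le_two)
  simp only [one_mul, hgp.mean_eq] at h1
  rw [h1]
  simp only [Pi.add_apply, mulVec, dotProduct]
  rw [integral_add (integrable_finsetSum _ fun j _ =>
      ((hgp.memLp s j).integrable one_le_two).const_mul _) (integrable_const _),
    integral_finsetSum _ fun j _ => ((hgp.memLp s j).integrable one_le_two).const_mul _]
  simp [integral_const_mul, hgp.mean_eq]

/-- The covariance with a past value is unchanged when `g t` is replaced by its conditional mean,
which is affine in `g s`; the offset then drops out. -/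
theorem IsMarkovWithTransitions.cov_eq {m : T → Fin D → ℝ}
    {K : T → T → Matrix (Fin D) (Fin D) ℝ} (hg : IsMarkovWithTransitions g P A b Q)
    (hgp : IsGP g P m K) {r s t : T} (hrs : r ≤ s) (hst : s ≤ t) : K t r = A t s * K s r := by
  ext i j
  set Y : Ω → ℝ := fun ω => (A t s *ᵥ g s ω + b t s) i with hY
  have hsum : Y = fun ω => (∑ k, A t s i k * g s ω k) + b t s i := by
    ext ω; simp [hY, mulVec, dotProduct]
  have hlin : MemLp (fun ω => ∑ k, A t s i k * g s ω k) 2 P :=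
    memLp_finsetSum _ fun k _ => (hgp.memLp s k).const_mul _
  have hYm : MemLp Y 2 P := by
    rw [hsum]; exact hlin.add (memLp_const _)
  have hmul := hg.integral_mul hst i (fun x => x ⟨r, hrs⟩ j)
    ((EuclideanSpace.proj (𝕜 := ℝ) j).continuous.measurable.comp (measurable_pi_apply _))
    ((hgp.memLp r j).integrable_mul (hgp.memLp t i))
  have hone := hg.integral_mul hst i (fun _ => 1) measurable_const
    (by simpa using (hgp.memLp t i).integrable one_le_two)
  simp only [one_mul] at hone
  have h : cov[fun ω => g r ω j, fun ω => g t ω i; P] = cov[fun ω => g r ω j, Y; P] := by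
    rw [covariance_eq_sub (hgp.memLp r j) (hgp.memLp t i),
      covariance_eq_sub (hgp.memLp r j) hYm]
    change ∫ ω, g r ω j * g t ω i ∂P - _ = ∫ ω, g r ω j * Y ω ∂P - _
    rw [hmul, hone]
  rw [← hgp.cov_eq, covariance_comm, h, hsum,
    covariance_add_const_right (hlin.integrable one_le_two),
    covariance_fun_sum_right (fun k => (hgp.memLp s k).const_mul _) (hgp.memLp r j)]
  simp only [covariance_const_mul_right, mul_apply]
  refine Finset.sum_congr rfl fun k _ => ?_
  rw [← hgp.cov_eq, covariance_comm]

end MarkovMoments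

/-! ### Space-time separable processes -/

section Separable

variable {T 𝒳 Ω : Type*} [MeasurableSpace Ω] {P : Measure Ω} [IsProbabilityMeasure P] {D NX : ℕ}
  {mt : T → Fin D → ℝ} {Kt : T → T → Matrix (Fin D) (Fin D) ℝ} {mx : 𝒳 → ℝ} {Kx : 𝒳 → 𝒳 → ℝ}
  {f : T × 𝒳 → Ω → EuclideanSpace ℝ (Fin D)}

theorem IsGP.posSemidef_gram {Z : Type*} {g : Z → Ω → EuclideanSpace ℝ (Fin D)}
    {m : Z → Fin D → ℝ} {K : Z → Z → Matrix (Fin D) (Fin D) ℝ} (hg : IsGP g P m K)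
    {ι : Type*} [Fintype ι] (Zs : ι → Z) (o : Fin D) :
    (_root_.gram (fun z z' => K z z' o o) Zs).PosSemidef := by
  refine PosSemidef.of_dotProduct_mulVec_nonneg ?_ fun c => ?_
  · rw [IsHermitian, conjTranspose_eq_transpose_of_trivial]
    ext i j
    exact congrFun (congrFun (hg.transpose_eq (Zs j) (Zs i)) o) o
  · refine (hg.sum_cov_nonneg Zs (fun _ => o) c).trans_eq ?_
    simp only [dotProduct, mulVec, Finset.mul_sum, _root_.gram, of_apply, star_trivial, mul_assoc]

variable (hf : IsGP f P (fun z i => mt z.1 i * mx z.2) (fun z z' => Kx z.2 z'.2 • Kt z.1 z'.1))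
include hf

/-- This is the two-time covariance of the state, so symmetry and positivity are read off from `f`
itself. The factor `Kx` alone need not have them: it is unconstrained where `Kt` vanishes. -/
theorem isPosSemidefKernel_separable (X : Fin NX → 𝒳) :
    IsPosSemidefKernel fun s t => Kt s t ⊗ₖ gram Kx X where
  transpose_eq s t := by
    ext ⟨i, p⟩ ⟨j, q⟩
    have h := congrFun (congrFun (hf.transpose_eq (s, X q) (t, X p)) i) j
    simp only [transpose_apply, Matrix.smul_apply, smul_eq_mul] at h
    simp only [transpose_apply, kroneckerMap_apply, _root_.gram, of_apply]
    rw [mul_comm, h, mul_comm]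
  nonneg m θ c := by
    refine (hf.sum_cov_nonneg (ι := Fin m × (Fin D × Fin NX)) (fun a => (θ a.1, X a.2.2))
      (fun a => a.2.1) (fun a => c a.1 a.2)).trans_eq ?_
    rw [Fintype.sum_prod_type]
    refine Finset.sum_congr rfl fun i _ => ?_
    simp_rw [Fintype.sum_prod_type (f := fun b : Fin m × (Fin D × Fin NX) => _)]
    rw [Finset.sum_comm]
    refine Finset.sum_congr rfl fun j _ => ?_
    simp only [dotProduct, mulVec, Finset.mul_sum]
    refine Finset.sum_congr rfl fun u _ => Finset.sum_congr rfl fun v _ => ?_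
    simp only [Matrix.smul_apply, smul_eq_mul, kroneckerMap_apply, _root_.gram, of_apply]
    ring

omit hf

/-- Transitions act on the temporal factor only, so the mixed-product rule for Kronecker products
lifts them to the state. -/
theorem isMarkovMoments_separable {Ω' : Type*} [MeasurableSpace Ω'] {P' : Measure Ω'}
    [IsProbabilityMeasure P'] [LinearOrder T] {ft : T → Ω' → EuclideanSpace ℝ (Fin D)}
    (hft : IsGP ft P' mt Kt) {At : T → T → Matrix (Fin D) (Fin D) ℝ} {bt : T → T → Fin D → ℝ}
    {Qt : T → T → Matrix (Fin D) (Fin D) ℝ} (hMarkov : IsMarkovWithTransitions ft P' At bt Qt)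
    (mx : 𝒳 → ℝ) (Kx : 𝒳 → 𝒳 → ℝ) (X : Fin NX → 𝒳) :
    IsMarkovMoments (fun t (p : Fin D × Fin NX) => mt t p.1 * mx (X p.2))
      (fun s t => Kt s t ⊗ₖ gram Kx X)
      (fun t s => At t s ⊗ₖ (1 : Matrix (Fin NX) (Fin NX) ℝ))
      (fun t s p => bt t s p.1 * mx (X p.2)) where
  mean_eq {s t} hst := by
    ext ⟨i, p⟩
    rw [hMarkov.mean_eq hft hst]
    simp only [Pi.add_apply, mulVec, dotProduct, kroneckerMap_apply, Fintype.sum_prod_type,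
      one_apply, mul_ite, mul_one, mul_zero, ite_mul, zero_mul, Finset.sum_ite_eq,
      Finset.mem_univ, if_true, add_mul, Finset.sum_mul, mul_assoc]
  cov_eq {r s t} hrs hst := by
    rw [← mul_kronecker_mul, Matrix.one_mul, hMarkov.cov_eq hft hrs hst]

end Separable

/-- Restricting a vector or matrix to selected coordinates. -/
theorem of_ite_mulVec_apply {O U : Type*} [Fintype U] [DecidableEq U] (e : O → U) (v : U → ℝ)
    (i : O) : ((Matrix.of fun j p => if p = e j then (1 : ℝ) else 0) *ᵥ v) i = v (e i) := by
  simp [mulVec, dotProduct]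

theorem mul_transpose_of_ite_apply {O U l : Type*} [Fintype U] [DecidableEq U] (e : O → U)
    (B : Matrix l U ℝ) (i : l) (j : O) :
    (B * (Matrix.of fun j p => if p = e j then (1 : ℝ) else 0)ᵀ) i j = B i (e j) := by
  simp [mul_apply]

theorem of_ite_mul_apply {O U l : Type*} [Fintype U] [DecidableEq U] (e : O → U)
    (B : Matrix U l ℝ) (i : O) (j : l) :
    ((Matrix.of fun j p => if p = e j then (1 : ℝ) else 0) * B) i j = B (e i) j := by
  simp [mul_apply]

/-! ### Identification with the batch posterior -/

theorem mainTheorem2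
    {tmin tmax : ℝ} {𝒳 Ω Ω' : Type*} [MeasurableSpace Ω] [MeasurableSpace Ω']
    (P : Measure Ω) [IsProbabilityMeasure P] (P' : Measure Ω') [IsProbabilityMeasure P']
    {D : ℕ} [NeZero D]
    -- temporal moments, spatial moments, temporal transition parameters
    (mt : Set.Icc tmin tmax → Fin D → ℝ)
    (Kt : Set.Icc tmin tmax → Set.Icc tmin tmax → Matrix (Fin D) (Fin D) ℝ)
    (mx : 𝒳 → ℝ) (Kx : 𝒳 → 𝒳 → ℝ)
    (At : Set.Icc tmin tmax → Set.Icc tmin tmax → Matrix (Fin D) (Fin D) ℝ)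
    (bt : Set.Icc tmin tmax → Set.Icc tmin tmax → Fin D → ℝ)
    (Qt : Set.Icc tmin tmax → Set.Icc tmin tmax → Matrix (Fin D) (Fin D) ℝ)
    -- the space-time separable Gauss-Markov process and its temporal factor
    (f : Set.Icc tmin tmax × 𝒳 → Ω → EuclideanSpace ℝ (Fin D))
    (hf : IsGP f P (fun z i => mt z.1 i * mx z.2) (fun z z' => Kx z.2 z'.2 • Kt z.1 z'.1))
    (ft : Set.Icc tmin tmax → Ω' → EuclideanSpace ℝ (Fin D))
    (hft : IsGP ft P' mt Kt)
    (hMarkov : IsMarkovWithTransitions ft P' At bt Qt)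
    -- training data at times `τ 1 < ⋯ < τ n`, initial time `τ 0`
    (σ : ℝ) (hσ : 0 ≤ σ) (n : ℕ) (τ : ℕ → Set.Icc tmin tmax)
    (hτ0 : τ 0 ≤ τ 1) (hτ : StrictMonoOn τ (Set.Icc 1 n))
    (N : ℕ → ℕ) (xtrain : ∀ k, Fin (N k) → 𝒳) (y : ∀ k, Fin (N k) → ℝ)
    -- test input, and spatial points with the test point as zeroth entry
    (t : Set.Icc tmin tmax) (x : 𝒳)
    {NX : ℕ} [NeZero NX] (X : Fin NX → 𝒳) (hX0 : X 0 = x)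
    (idx : ∀ k, Fin (N k) → Fin NX) (hidx : ∀ k ∈ Set.Icc 1 n, ∀ j, X (idx k j) = xtrain k j)
    -- subroutines of the filter
    (lsqrt : SquareRoutine) (hlsqrt : IsLeftSqrt lsqrt)
    (policy : (separableModel mt Kt mx Kx At bt X σ n τ N idx y).Policy) :
    let M := separableModel mt Kt mx Kx At bt X σ n τ N idx y
    let μ : Set.Icc tmin tmax × 𝒳 → ℝ := fun z => ∫ ω, f z ω 0 ∂P
    let K : Set.Icc tmin tmax × 𝒳 → Set.Icc tmin tmax × 𝒳 → ℝ :=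
      fun z z' => cov[fun ω => f z ω 0, fun ω => f z' ω 0; P]
    let Ztrain : (Σ k : Fin M.n, Fin (M.N (k + 1))) → Set.Icc tmin tmax × 𝒳 :=
      fun i => (τ (i.1 + 1), xtrain (i.1 + 1) i.2)
    let ytrain : (Σ k : Fin M.n, Fin (M.N (k + 1))) → ℝ := fun i => y (i.1 + 1) i.2
    let S := M.actions lsqrt policy
    -- noise-free data have to be consistent with the prior
    (σ = 0 → ∃ v, (Sᵀ * gram K Ztrain * S) *ᵥ v = Sᵀ *ᵥ (fun i => ytrain i - μ (Ztrain i))) →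
    (M.caksMean lsqrt policy t (0, 0) = approxPostMean μ K σ Ztrain ytrain S (t, x) ∧
      M.caksCov lsqrt policy t (0, 0) (0, 0) = approxPostCov K σ Ztrain S (t, x) (t, x)) ∧
    (τ n ≤ t →
      M.cakfMean lsqrt policy t (0, 0) = approxPostMean μ K σ Ztrain ytrain S (t, x) ∧
      M.cakfCov lsqrt policy t (0, 0) (0, 0) = approxPostCov K σ Ztrain S (t, x) (t, x)) := by
  intro M μ K Ztrain ytrain S hcons
  -- The algorithm sees only the diagonal `s = t` of this kernel; the comparison needs all of it.
  set 𝒦 : Set.Icc tmin tmax → Set.Icc tmin tmax →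
      Matrix (Fin D × Fin NX) (Fin D × Fin NX) ℝ := fun s t => Kt s t ⊗ₖ gram Kx X
  have hμ : ∀ z, μ z = mt z.1 0 * mx z.2 := fun z => hf.mean_eq z 0
  have hKe : K = fun z z' => (Kx z.2 z'.2 • Kt z.1 z'.1) 0 0 := by
    funext z z'
    exact hf.cov_eq z z' 0 0
  have hKz : ∀ s s' a a', K (s, a) (s', a') = Kt s s' 0 0 * Kx a a' := fun s s' a a' =>
    (hf.cov_eq (s, a) (s', a') 0 0).trans (mul_comm _ _)
  -- Positivity comes from `f` and the Markov relations from `ft`; the two processes need only share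
  -- the temporal moments.
  have h : M.IsGaussMarkov 𝒦 :=
    { posSemidef := isPosSemidefKernel_separable hf X
      diag := fun _ => rfl
      noise := fun k => PosSemidef.one.smul (sq_nonneg σ)
      markov := isMarkovMoments_separable hft hMarkov mx Kx X
      time_le := by
        intro j k hjk hkn
        change τ j ≤ τ k
        change k ≤ n at hkn
        have hmono : ∀ j k, 1 ≤ j → j ≤ k → k ≤ n → τ j ≤ τ k := fun j k h1 h2 h3 =>
          hτ.monotoneOn ⟨h1, h2.trans h3⟩ ⟨h1.trans h2, h3⟩ h2
        rcases Nat.eq_zero_or_pos j with rfl | hj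
        · rcases Nat.eq_zero_or_pos k with rfl | hk
          · exact le_rfl
          · exact hτ0.trans (hmono 1 k le_rfl hk hkn)
        · exact hmono j k hj hjk hkn }
  set O := M.obs lsqrt policy 𝒦
  -- Block `k : Fin M.n` belongs to step `k + 1`, which is within the range covered by `hidx`.
  have hidx' : ∀ (k : Fin M.n) (j : Fin (N (k + 1))), X (idx (k + 1) j) = xtrain (k + 1) j :=
    fun k j => hidx _ ⟨by omega, k.2⟩ j
  have hL := CDModel.posSemidef_obs_L (lsqrt := lsqrt) (policy := policy) h
  have hbatch : O.batchCov M.n = Sᵀ * (gram K Ztrain + σ ^ 2 • 1) * S := by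
    refine ObsSequence.batchCov_eq (O := O) (H := fun k : Fin M.n => M.H (k + 1))
      (fun k => rfl) (fun k => rfl) fun i j => ?_
    refine Eq.trans ?_ (mul_transpose_of_ite_apply (fun a => ((0 : Fin D), idx (j.1 + 1) a))
      _ _ _).symm
    refine Eq.trans ?_ (of_ite_mul_apply (fun a => ((0 : Fin D), idx (i.1 + 1) a)) _ _ _).symm
    exact (hKz _ _ _ _).trans (congrArg₂ (fun a b => Kt _ _ 0 0 * Kx a b)
      (hidx' i.1 i.2).symm (hidx' j.1 j.2).symm)
  have hcross : O.crossCov M.n t (0, 0) = Sᵀ *ᵥ fun i => K (t, x) (Ztrain i) := by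
    refine ObsSequence.crossCov_eq (O := O) (H := fun k : Fin M.n => M.H (k + 1))
      (fun k => rfl) t (0, 0) fun i => ?_
    refine Eq.trans ?_ (mul_transpose_of_ite_apply (fun a => ((0 : Fin D), idx (i.1 + 1) a))
      _ _ _).symm
    exact (hKz _ _ _ _).trans (congrArg₂ (fun a b => Kt _ _ 0 0 * Kx a b)
      hX0.symm (hidx' i.1 i.2).symm)
  have hres : O.residual M.n = Sᵀ *ᵥ fun i => ytrain i - μ (Ztrain i) := by
    refine ObsSequence.residual_eq (O := O) (H := fun k : Fin M.n => M.H (k + 1))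
      (fun k => rfl) (y := fun k => y (k + 1)) (fun k => rfl) fun i => ?_
    refine congrArg₂ HSub.hSub rfl ?_
    refine Eq.trans ?_ (of_ite_mulVec_apply (fun a => ((0 : Fin D), idx (i.1 + 1) a)) _ _).symm
    exact (hμ _).trans (congrArg (fun a => mt _ 0 * mx a) (hidx' i.1 i.2).symm)
  -- Consistency of the residual: the hypothesis if `σ = 0`, automatic from positive noise
  -- otherwise.
  have hcons' : ∃ v, O.batchCov M.n *ᵥ v = O.residual M.n := by
    rw [hbatch, hres]
    rcases hσ.eq_or_lt with h0 | h0
    · obtain ⟨v, hv⟩ := hcons h0.symm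
      refine ⟨v, ?_⟩
      rw [← hv, ← h0, zero_pow two_ne_zero, zero_smul, add_zero]
      rfl
    · refine exists_mulVec_eq_of_pos_noise ?_ h0 S _
      rw [hKe]
      exact hf.posSemidef_gram Ztrain 0
  have hmean : O.mean M.n t (0, 0) = approxPostMean μ K σ Ztrain ytrain S (t, x) := by
    rw [ObsSequence.mean_eq_batch h.posSemidef hL M.n t hcons', hbatch, hres, approxPostMean, hμ,
      approxPrecision, ← mulVec_mulVec, ← mulVec_mulVec, dotProduct_mulVec, ← mulVec_transpose,
      ← hcross]
    change mt t 0 * mx (X 0) + _ = _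
    rw [hX0]
    rfl
  have hcov : O.cov M.n t t (0, 0) (0, 0) = approxPostCov K σ Ztrain S (t, x) (t, x) := by
    have hsymm : (fun i => K (Ztrain i) (t, x)) = fun i => K (t, x) (Ztrain i) :=
      funext fun i => covariance_comm _ _
    rw [ObsSequence.cov_eq_batch h.posSemidef hL M.n t t, hbatch, approxPostCov,
      approxPrecision, ← mulVec_mulVec, ← mulVec_mulVec, dotProduct_mulVec, ← mulVec_transpose,
      hsymm, ← hcross, Matrix.mul_assoc]
    have hprior : O.K t t (0, 0) (0, 0) = K (t, x) (t, x) := by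
      change Kt t t 0 0 * Kx (X 0) (X 0) = _
      rw [hX0, hKz]
    rw [← hprior, Matrix.sub_apply]
    rfl
  refine ⟨?_, fun ht => ?_⟩
  · obtain ⟨h1, h2⟩ := CDModel.smoothAt_eq (policy := policy) h hlsqrt t
    rw [h1, h2]
    exact ⟨hmean, hcov⟩
  · obtain ⟨h1, h2⟩ := CDModel.filterAt_eq_of_le (policy := policy) h hlsqrt (t := t) ht
    rw [h1, h2]
    exact ⟨hmean, hcov⟩
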